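/- Let $k$ be a field. A *proalgebraic group* is an affine group scheme $G$ over $k$, with coordinate ring $k[G]$ (a commutative Hopf algebra); it is *algebraic* if $k[G]$ is a finitely generated $k$-algebra. A morphism $G\to H$ is an *epimorphism*, written $G\twoheadrightarrow H$, if the dual map $k[H]\to k[G]$ is injective. A closed normal subgroup $N$ of $G$ is *coalgebraic* if $G/N$ is algebraic. A set $\mathcal N$ of coalgebraic subgroups of $G$ is a *neighborhood basis at $1$* if every coalgebraic subgroup of $G$ contains a member of $\mathcal N$. The *rank* of $G$ is $0$ if $G$ is trivial, and otherwise it is the smallest cardinality of a neighborhood basis at $1$ for $G$. A *formation* $\mathcal C$ is a class of algebraic groups over $k$ that is closed under isomorphism, contains a non-trivial group, and satisfies: (i) if $G\twoheadrightarrow H$ is an epimorphism of algebraic groups and $G\in\mathcal C$, then $H\in\mathcal C$; (ii) if $G_1,G_2\in\mathcal C$ and $H$ is a closed subgroup of $G_1\times G_2$ such that both projections $H\to G_i$ are epimorphisms, then $H\in\mathcal C$. A *pro-$\mathcal C$-group* is a proalgebraic group that is the projective limit, over a directed partially ordered set, of groups in $\mathcal C$ with epimorphisms as transition maps. A pro-$\mathcal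 C$-group $\Gamma$ is *saturated* if for all epimorphisms $\alpha\colon G\twoheadrightarrow H$ and $\beta\colon\Gamma\twoheadrightarrow H$ of pro-$\mathcal C$-groups with $\operatorname{rank}(H)<\operatorname{rank}(\Gamma)$ and $\operatorname{rank}(G)\le\operatorname{rank}(\Gamma)$ there exists an epimorphism $\varphi\colon\Gamma\twoheadrightarrow G$ with $\alpha\circ\varphi=\beta$. **Theorem.** Let $\mathcal C$ be a formation and let $\Gamma$ and $\Gamma'$ be saturated pro-$\mathcal C$-groups with $\operatorname{rank}(\Gamma)=\operatorname{rank}(\Gamma')$. Then $\Gamma$ and $\Gamma'$ are isomorphic. -/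

import Mathlib

open CategoryTheory

universe u v

/-- A proalgebraic group over `k`, i.e. an affine group scheme over `k`, given by its coordinate
ring, a commutative Hopf algebra. The category of affine group schemes over `k` is the opposite of
the category of commutative Hopf algebras over `k`, so a morphism `G ⟶ H` is a homomorphism of Hopf
algebras `k[H] → k[G]`, and isomorphism is isomorphism in this category. -/
abbrev ProalgebraicGroup (k : Type u) [Field k] : Type (max u (v + 1)) :=
  (CommHopfAlgCat.{v} k)ᵒᵖ

namespace ProalgebraicGroup

variable {k : Type u} [Field k]

/-- The coordinate ring `k[G]`. -/
abbrev coordRing (G : ProalgebraicGroup.{u, v} k) : Type v := G.unop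

/-- The dual map `f^* : k[H] → k[G]` of a morphism `f : G ⟶ H`. -/
abbrev dual {G H : ProalgebraicGroup.{u, v} k} (f : G ⟶ H) : H.coordRing →ₐc[k] G.coordRing :=
  f.unop.hom

/-- `f : G ⟶ H` is an epimorphism of proalgebraic groups, `f(G) = H`: the dual map is injective.
(This is stronger than being an epimorphism in the sense of category theory.) -/
def IsEpimorphism {G H : ProalgebraicGroup.{u, v} k} (f : G ⟶ H) : Prop :=
  Function.Injective (dual f)

/-- An algebraic group: an affine group scheme of finite type over `k`. -/
def IsAlgebraic (G : ProalgebraicGroup.{u, v} k) : Prop :=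
  Algebra.FiniteType k G.coordRing

/-- The trivial group `Spec k`. -/
def IsTrivial (G : ProalgebraicGroup.{u, v} k) : Prop :=
  Function.Bijective (algebraMap k G.coordRing)

/-- The set `G(R)` of `R`-valued points of `G`. -/
abbrev Points (G : ProalgebraicGroup.{u, v} k) (R : Type v) [CommRing R] [Algebra k R] : Type v :=
  G.coordRing →ₐ[k] R

/-- The map `f_R : G(R) → H(R)` induced by a morphism `f : G ⟶ H`. -/
def mapPoints {G H : ProalgebraicGroup.{u, v} k} (f : G ⟶ H) (R : Type v) [CommRing R]
    [Algebra k R] (g : G.Points R) : H.Points R :=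
  g.comp (dual f : H.coordRing →ₐ[k] G.coordRing)

/-- A class `C` of algebraic groups over `k` is a formation: it is closed under isomorphism, under
quotients and under subdirect products, and contains a non-trivial group. -/
structure IsFormation (C : ProalgebraicGroup.{u, v} k → Prop) : Prop where
  isAlgebraic : ∀ G, C G → G.IsAlgebraic
  of_iso : ∀ G H : ProalgebraicGroup.{u, v} k, Nonempty (G ≅ H) → C G → C H
  exists_nontrivial : ∃ G, C G ∧ ¬ G.IsTrivial
  quotient : ∀ (G H : ProalgebraicGroup.{u, v} k) (f : G ⟶ H),
    IsEpimorphism f → H.IsAlgebraic → C G → C H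
  /-- The surjectivity says that `(p₁, p₂) : H → G₁ × G₂` is a closed immersion. -/
  subdirect : ∀ (H G₁ G₂ : ProalgebraicGroup.{u, v} k) (p₁ : H ⟶ G₁) (p₂ : H ⟶ G₂),
    Function.Surjective (Algebra.TensorProduct.productMap
      (dual p₁ : G₁.coordRing →ₐ[k] H.coordRing) (dual p₂ : G₂.coordRing →ₐ[k] H.coordRing)) →
    IsEpimorphism p₁ → IsEpimorphism p₂ → C G₁ → C G₂ → C H

/-- `Γ`, with the projections `p i : Γ ⟶ G i`, is the projective limit of the projective system
`(G, t)` over the partially ordered set `I`. Projective limits of affine group schemes are taken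
pointwise: `Γ(R)` is the limit of the `G i (R)` for every `k`-algebra `R`. -/
structure IsProjectiveLimit {I : Type v} [PartialOrder I] (G : I → ProalgebraicGroup.{u, v} k)
    (t : ∀ i j : I, i ≤ j → (G j ⟶ G i)) (Γ : ProalgebraicGroup.{u, v} k)
    (p : ∀ i, Γ ⟶ G i) : Prop where
  map_id : ∀ i, t i i le_rfl = 𝟙 (G i)
  map_comp : ∀ (i j l : I) (hij : i ≤ j) (hjl : j ≤ l),
    t j l hjl ≫ t i j hij = t i l (hij.trans hjl)
  compatible : ∀ (i j : I) (hij : i ≤ j), p j ≫ t i j hij = p i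
  points : ∀ (R : Type v) [CommRing R] [Algebra k R] (x : ∀ i, (G i).Points R),
    (∀ (i j : I) (hij : i ≤ j), mapPoints (t i j hij) R (x j) = x i) →
      ∃! y : Γ.Points R, ∀ i, mapPoints (p i) R y = x i

/-- `Γ` is a pro-`C`-group: a projective limit, over a directed partially ordered set, of
`C`-groups whose transition maps are epimorphisms. -/
def IsPro (C : ProalgebraicGroup.{u, v} k → Prop) (Γ : ProalgebraicGroup.{u, v} k) : Prop :=
  ∃ (I : Type v) (_ : PartialOrder I) (G : I → ProalgebraicGroup.{u, v} k)
    (t : ∀ i j : I, i ≤ j → (G j ⟶ G i)) (p : ∀ i, Γ ⟶ G i),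
    Nonempty I ∧ IsDirected I (· ≤ ·) ∧ (∀ i, C (G i)) ∧
      (∀ (i j : I) (hij : i ≤ j), IsEpimorphism (t i j hij)) ∧ IsProjectiveLimit G t Γ p

/-- A coalgebraic subgroup `N` of `G`, i.e. a closed normal subgroup such that `G/N` is algebraic.
A closed normal subgroup `N` is given by the Hopf subalgebra `k[G/N]` of `k[G]`; this is the usual
one-to-one correspondence between closed normal subgroups and Hopf subalgebras. -/
structure CoalgebraicSubgroup (G : ProalgebraicGroup.{u, v} k) where
  /-- The coordinate ring `k[G/N]` inside `k[G]`. -/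
  quotientRing : Subalgebra k G.coordRing
  comul_mem : ∀ a ∈ quotientRing, Coalgebra.comul (R := k) a ∈
    (Algebra.TensorProduct.map quotientRing.val quotientRing.val).range
  antipode_mem : ∀ a ∈ quotientRing, HopfAlgebra.antipode k a ∈ quotientRing
  fg : quotientRing.FG

/-- Inclusion `N' ≤ N` of subgroups, that is, `k[G/N] ⊆ k[G/N']`. -/
instance (G : ProalgebraicGroup.{u, v} k) : LE G.CoalgebraicSubgroup where
  le N' N := N.quotientRing ≤ N'.quotientRing

/-- A set of coalgebraic subgroups of `G` is a neighborhood basis at `1` if every coalgebraic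
subgroup contains a member of it. -/
def IsNeighborhoodBasis {G : ProalgebraicGroup.{u, v} k} (S : Set G.CoalgebraicSubgroup) : Prop :=
  ∀ N : G.CoalgebraicSubgroup, ∃ N' ∈ S, N' ≤ N

open Classical in
/-- The rank of `G`: `0` if `G` is trivial, and otherwise the smallest cardinality of a
neighborhood basis at `1`. -/
noncomputable def rank (G : ProalgebraicGroup.{u, v} k) : Cardinal.{v} :=
  if G.IsTrivial then 0
  else sInf {κ | ∃ S : Set G.CoalgebraicSubgroup, IsNeighborhoodBasis S ∧ Cardinal.mk S = κ}

/-- `Γ` is a saturated pro-`C`-group: every pro-`C`-embedding problem `α : G ⟶ H`, `β : Γ ⟶ H`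
for `Γ` with `rank H < rank Γ` and `rank G ≤ rank Γ` has a solution. -/
def IsSaturated (C : ProalgebraicGroup.{u, v} k → Prop) (Γ : ProalgebraicGroup.{u, v} k) : Prop :=
  IsPro C Γ ∧
    ∀ (G H : ProalgebraicGroup.{u, v} k) (α : G ⟶ H) (β : Γ ⟶ H),
      IsEpimorphism α → IsEpimorphism β → IsPro C G → H.rank < Γ.rank → G.rank ≤ Γ.rank →
        ∃ φ : Γ ⟶ G, IsEpimorphism φ ∧ φ ≫ α = β

end ProalgebraicGroup

/-! The proof is a back-and-forth argument of transfinite length. A common quotient `P` of `Γ` and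
`Γ'` is encoded as a subalgebra of `k[Γ] × k[Γ']`, closed under the Hopf operations, on which both
projections are injective: the graph of an isomorphism between Hopf subalgebras
(`IsHopfCorrespondence.exists_common_quotient`). Such graphs can be joined inside one fixed ring, so
limit stages need no gluing of isomorphisms.

Let `κ` be the common rank. If `κ` is finite and nonzero, `Γ` is algebraic, so `Γ × Γ` lies in `C`,
and saturation over the trivial group gives an epimorphism `Γ ↠ Γ × Γ`. A nonzero finitely generated
algebra `A ≠ k` admits no embedding `A ⊗ A → A`, so this is impossible, and a nontrivial `Γ` has
infinite rank.

For infinite `κ`, neighborhood bases of both groups are indexed by the initial ordinal of `κ`.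
Before stage `i` the graph is generated by fewer than `κ` finitely generated correspondences, so `P`
has rank below `κ` (`Separates.rank_lt`). For a basis member `B` of `Γ`, let `G` be the quotient of
`Γ` with `k[G]` generated by `k[P]` and `k[Γ/B]`; its rank is still below `κ`. Saturation of `Γ'`
lifts `Γ' ↠ P` to `Γ' ↠ G`, so `k[Γ/B]` enters the graph (`IsSaturated.exists_extension`); the
symmetric step treats `Γ'`. The final graph projects onto both coordinate rings. -/

/-- Factor an algebra homomorphism through an injective one. -/
noncomputable def AlgHom.factorOfInjective {k X Y Z : Type*} [CommSemiring k] [Semiring X] [Semiring Y]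
    [Semiring Z] [Algebra k X] [Algebra k Y] [Algebra k Z] (g : Y →ₐ[k] Z)
    (hg : Function.Injective g) (f : X →ₐ[k] Z) (h : ∀ x, f x ∈ g.range) : X →ₐ[k] Y :=
  (AlgEquiv.ofInjective g hg).symm.toAlgHom.comp (f.codRestrict g.range h)

lemma AlgHom.apply_factorOfInjective {k X Y Z : Type*} [CommSemiring k] [Semiring X] [Semiring Y]
    [Semiring Z] [Algebra k X] [Algebra k Y] [Algebra k Z] (g : Y →ₐ[k] Z)
    (hg : Function.Injective g) (f : X →ₐ[k] Z) (h : ∀ x, f x ∈ g.range) (x : X) :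
    g (g.factorOfInjective hg f h x) = f x :=
  congrArg Subtype.val ((AlgEquiv.ofInjective g hg).apply_symm_apply (f.codRestrict g.range h x))

lemma AlgHom.comp_factorOfInjective {k X Y Z : Type*} [CommSemiring k] [Semiring X] [Semiring Y]
    [Semiring Z] [Algebra k X] [Algebra k Y] [Algebra k Z] (g : Y →ₐ[k] Z)
    (hg : Function.Injective g) (f : X →ₐ[k] Z) (h : ∀ x, f x ∈ g.range) :
    g.comp (g.factorOfInjective hg f h) = f :=
  AlgHom.ext (g.apply_factorOfInjective hg f h)

/-! ### Hopf structures and homomorphisms along injections -/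

section HopfAlgebra

open TensorProduct Coalgebra Bialgebra HopfAlgebra

variable {k : Type*} [Field k]

/-- Everything is flat over a field. Hence identities in tensor powers of a Hopf subalgebra may be
checked in the ambient ones. -/
lemma Algebra.TensorProduct.map_injective_of_field {X Y X' Y' : Type*} [Ring X] [Ring Y]
    [Ring X'] [Ring Y'] [Algebra k X] [Algebra k Y] [Algebra k X'] [Algebra k Y']
    {f : X →ₐ[k] X'} {g : Y →ₐ[k] Y'} (hf : Function.Injective f) (hg : Function.Injective g) :
    Function.Injective (Algebra.TensorProduct.map f g) :=
  _root_.TensorProduct.map_injective_of_flat_flat f.toLinearMap g.toLinearMap hf hg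

/-- Homomorphisms of commutative bialgebras between Hopf algebras respect the antipode. -/
lemma BialgHom.map_antipode {A B : Type*} [CommRing A] [CommRing B] [HopfAlgebra k A]
    [HopfAlgebra k B] (f : A →ₐc[k] B) (a : A) : f (antipode k a) = antipode k (f a) := by
  -- Both sides are convolution inverses of `f`, one on the left and one on the right, so they
  -- agree.
  have h1 : WithConv.toConv ((antipode k).comp (f : A →ₗ[k] B)) *
      WithConv.toConv (f : A →ₗ[k] B) = 1 := by
    have := LinearMap.convMul_comp_coalgHom_distrib (R := k)
      (WithConv.toConv (antipode k (A := B))) (WithConv.toConv LinearMap.id) (f : A →ₗc[k] B)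
    rw [LinearMap.antipode_mul_id] at this
    apply WithConv.ext
    refine Eq.trans this.symm ?_
    ext x
    simp
  have h2 : WithConv.toConv (f : A →ₗ[k] B) *
      WithConv.toConv ((f : A →ₗ[k] B).comp (antipode k)) = 1 := by
    have := LinearMap.algHom_comp_convMul_distrib (R := k) (f : A →ₐ[k] B)
      (WithConv.toConv LinearMap.id) (WithConv.toConv (antipode k (A := A)))
    rw [LinearMap.id_mul_antipode] at this
    apply WithConv.ext
    refine Eq.trans this.symm ?_
    ext x
    simpa using AlgHomClass.commutes f _
  have h := left_inv_eq_right_inv h1 h2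
  exact congr(($h).ofConv a).symm

variable {R A : Type*} [CommRing R] [Algebra k R] [CommRing A] [HopfAlgebra k A]

/-- The Hopf algebra structure on `R` induced by an injective algebra homomorphism `i : R → A` into
a Hopf algebra whose image is a Hopf subalgebra. -/
@[reducible]
noncomputable def HopfAlgebra.ofInjective (i : R →ₐ[k] A) (hi : Function.Injective i)
    (hΔ : ∀ r, comul (R := k) (i r) ∈ (Algebra.TensorProduct.map i i).range)
    (hS : ∀ r, antipode k (i r) ∈ i.range) : HopfAlgebra k R :=
  have hii := Algebra.TensorProduct.map_injective_of_field hi hi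
  let Δ : R →ₐ[k] R ⊗[k] R := (Algebra.TensorProduct.map i i).factorOfInjective hii
    ((comulAlgHom k A).comp i) hΔ
  let S : R →ₐ[k] R := i.factorOfInjective hi ((antipodeAlgHom k A).comp i) hS
  let ε : R →ₐ[k] k := (counitAlgHom k A).comp i
  have hΔ' : (Algebra.TensorProduct.map i i).comp Δ = (comulAlgHom k A).comp i :=
    AlgHom.comp_factorOfInjective _ _ _ _
  have hS' : i.comp S = (antipodeAlgHom k A).comp i := AlgHom.comp_factorOfInjective _ _ _ _
  have hΔ'' (r : R) : Algebra.TensorProduct.map i i (Δ r) = comul (i r) := congr($hΔ' r)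
  -- Each axiom is checked after applying an injective tensor power of `i`, where it becomes the
  -- axiom of `A` at `i r`.
  letI : Bialgebra k R := Bialgebra.ofAlgHom Δ ε
    (by
      refine AlgHom.ext fun r => Algebra.TensorProduct.map_injective_of_field hi hii ?_
      have h1 : (Algebra.TensorProduct.map i (Algebra.TensorProduct.map i i)).comp
          ((Algebra.TensorProduct.assoc k k k R R R).toAlgHom.comp
            (Algebra.TensorProduct.map Δ (.id k R))) =
          (Algebra.TensorProduct.assoc k k k A A A).toAlgHom.comp
            ((Algebra.TensorProduct.map (comulAlgHom k A) (.id k A)).comp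
              (Algebra.TensorProduct.map i i)) := by
        have h3 : (Algebra.TensorProduct.map i (Algebra.TensorProduct.map i i)).comp
            (Algebra.TensorProduct.assoc k k k R R R).toAlgHom =
            (Algebra.TensorProduct.assoc k k k A A A).toAlgHom.comp
              (Algebra.TensorProduct.map (Algebra.TensorProduct.map i i) i) := by
          ext <;> simp [Algebra.TensorProduct.one_def]
        rw [← AlgHom.comp_assoc, h3, AlgHom.comp_assoc, ← Algebra.TensorProduct.map_comp, hΔ',
          ← Algebra.TensorProduct.map_comp, AlgHom.comp_id, AlgHom.id_comp]
      have h2 : (Algebra.TensorProduct.map i (Algebra.TensorProduct.map i i)).comp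
          (Algebra.TensorProduct.map (.id k R) Δ) =
            (Algebra.TensorProduct.map (.id k A) (comulAlgHom k A)).comp
              (Algebra.TensorProduct.map i i) := by
        rw [← Algebra.TensorProduct.map_comp, hΔ', ← Algebra.TensorProduct.map_comp,
          AlgHom.comp_id, AlgHom.id_comp]
      refine congr($h1 (Δ r)).trans (Eq.trans ?_ congr($h2 (Δ r)).symm)
      simp only [AlgHom.comp_apply, hΔ'']
      exact coassoc_apply (R := k) (i r))
    (by
      refine AlgHom.ext fun r => Algebra.TensorProduct.map_injective_of_field
        (f := AlgHom.id k k) Function.injective_id hi ?_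
      have h1 : (Algebra.TensorProduct.map (.id k k) i).comp
          (Algebra.TensorProduct.map ε (.id k R)) =
            (Algebra.TensorProduct.map (counitAlgHom k A) (.id k A)).comp
              (Algebra.TensorProduct.map i i) := by
        rw [← Algebra.TensorProduct.map_comp, ← Algebra.TensorProduct.map_comp,
          AlgHom.comp_id, AlgHom.id_comp, AlgHom.id_comp]
      refine congr($h1 (Δ r)).trans ?_
      simp only [AlgHom.comp_apply, hΔ'']
      exact (rTensor_counit_comul (R := k) (i r)).trans (by simp))
    (by
      refine AlgHom.ext fun r => Algebra.TensorProduct.map_injective_of_field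
        (g := AlgHom.id k k) hi Function.injective_id ?_
      have h1 : (Algebra.TensorProduct.map i (.id k k)).comp
          (Algebra.TensorProduct.map (.id k R) ε) =
            (Algebra.TensorProduct.map (.id k A) (counitAlgHom k A)).comp
              (Algebra.TensorProduct.map i i) := by
        rw [← Algebra.TensorProduct.map_comp, ← Algebra.TensorProduct.map_comp,
          AlgHom.comp_id, AlgHom.id_comp, AlgHom.id_comp]
      refine congr($h1 (Δ r)).trans ?_
      simp only [AlgHom.comp_apply, hΔ'']
      exact (lTensor_counit_comul (R := k) (i r)).trans (by simp))
  { antipode := S.toLinearMap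
    mul_antipode_rTensor_comul := by
      refine LinearMap.ext fun r => hi ?_
      have h1 : i.comp ((Algebra.TensorProduct.lmul' k).comp
          (Algebra.TensorProduct.map S (.id k R))) =
          (Algebra.TensorProduct.lmul' k).comp
            ((Algebra.TensorProduct.map (antipodeAlgHom k A) (.id k A)).comp
              (Algebra.TensorProduct.map i i)) := by
        have h3 : i.comp (Algebra.TensorProduct.lmul' k) =
            (Algebra.TensorProduct.lmul' k).comp (Algebra.TensorProduct.map i i) := by
          ext <;> simp
        rw [← AlgHom.comp_assoc, h3, AlgHom.comp_assoc, ← Algebra.TensorProduct.map_comp,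
          ← Algebra.TensorProduct.map_comp, AlgHom.comp_id, AlgHom.id_comp, hS']
      refine congr($h1 (Δ r)).trans ?_
      simp only [AlgHom.comp_apply, hΔ'']
      exact (mul_antipode_rTensor_comul_apply (R := k) (i r)).trans (i.commutes _).symm
    mul_antipode_lTensor_comul := by
      refine LinearMap.ext fun r => hi ?_
      have h1 : i.comp ((Algebra.TensorProduct.lmul' k).comp
          (Algebra.TensorProduct.map (.id k R) S)) =
          (Algebra.TensorProduct.lmul' k).comp
            ((Algebra.TensorProduct.map (.id k A) (antipodeAlgHom k A)).comp
              (Algebra.TensorProduct.map i i)) := by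
        have h3 : i.comp (Algebra.TensorProduct.lmul' k) =
            (Algebra.TensorProduct.lmul' k).comp (Algebra.TensorProduct.map i i) := by
          ext <;> simp
        rw [← AlgHom.comp_assoc, h3, AlgHom.comp_assoc, ← Algebra.TensorProduct.map_comp,
          ← Algebra.TensorProduct.map_comp, AlgHom.comp_id, AlgHom.id_comp, hS']
      refine congr($h1 (Δ r)).trans ?_
      simp only [AlgHom.comp_apply, hΔ'']
      exact (mul_antipode_lTensor_comul_apply (R := k) (i r)).trans (i.commutes _).symm }

/-- The injection defining `HopfAlgebra.ofInjective`, as a homomorphism of bialgebras. -/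
noncomputable def HopfAlgebra.ofInjectiveHom (i : R →ₐ[k] A) (hi : Function.Injective i)
    (hΔ : ∀ r, comul (R := k) (i r) ∈ (Algebra.TensorProduct.map i i).range)
    (hS : ∀ r, antipode k (i r) ∈ i.range) :
    letI := HopfAlgebra.ofInjective i hi hΔ hS
    R →ₐc[k] A :=
  letI := HopfAlgebra.ofInjective i hi hΔ hS
  BialgHom.ofAlgHom i rfl (AlgHom.comp_factorOfInjective _
    (Algebra.TensorProduct.map_injective_of_field hi hi) _ hΔ)

/-- An algebra homomorphism is one of bialgebras if its composite with an injective homomorphism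
of bialgebras is. -/
noncomputable def BialgHom.ofCompInjective {X Y Z : Type*} [CommRing X] [CommRing Y] [CommRing Z]
    [Bialgebra k X] [Bialgebra k Y] [Bialgebra k Z] (g : Y →ₐc[k] Z) (hg : Function.Injective g)
    (h : X →ₐc[k] Z) (f : X →ₐ[k] Y) (hf : ∀ x, g (f x) = h x) : X →ₐc[k] Y :=
  have hf' : (g : Y →ₐ[k] Z).comp f = h := AlgHom.ext hf
  .ofAlgHom f
    (by rw [← BialgHom.counitAlgHom_comp g, AlgHom.comp_assoc, hf', BialgHom.counitAlgHom_comp])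
    (by
      refine AlgHom.ext fun x => Algebra.TensorProduct.map_injective_of_field
        (f := (g : Y →ₐ[k] Z)) (g := (g : Y →ₐ[k] Z)) hg hg ?_
      have h1 := BialgHom.map_comp_comulAlgHom h
      rw [← hf', Algebra.TensorProduct.map_comp, ← AlgHom.comp_assoc (comulAlgHom k Z),
        ← BialgHom.map_comp_comulAlgHom g, AlgHom.comp_assoc, AlgHom.comp_assoc] at h1
      exact congr($h1 x))

/-- Factor a homomorphism of bialgebras through an injective one. -/
noncomputable def BialgHom.factorOfInjective {X Y Z : Type*} [CommRing X] [CommRing Y] [CommRing Z]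
    [Bialgebra k X] [Bialgebra k Y] [Bialgebra k Z] (g : Y →ₐc[k] Z) (hg : Function.Injective g)
    (h : X →ₐc[k] Z) (hr : ∀ x, ∃ y, g y = h x) : X →ₐc[k] Y :=
  .ofCompInjective g hg h ((g : Y →ₐ[k] Z).factorOfInjective hg (h : X →ₐ[k] Z) hr)
    (AlgHom.apply_factorOfInjective (g : Y →ₐ[k] Z) hg (h : X →ₐ[k] Z) hr)

lemma BialgHom.apply_factorOfInjective {X Y Z : Type*} [CommRing X] [CommRing Y] [CommRing Z]
    [Bialgebra k X] [Bialgebra k Y] [Bialgebra k Z] (g : Y →ₐc[k] Z) (hg : Function.Injective g)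
    (h : X →ₐc[k] Z) (hr : ∀ x, ∃ y, g y = h x) (x : X) :
    g (g.factorOfInjective hg h hr x) = h x :=
  AlgHom.apply_factorOfInjective (g : Y →ₐ[k] Z) hg (h : X →ₐ[k] Z) hr x

end HopfAlgebra

/-! ### Quotients and Hopf subalgebras -/

namespace ProalgebraicGroup

open TensorProduct Coalgebra Bialgebra HopfAlgebra

variable {k : Type u} [Field k]

/-- The image of the dual map of `f : G ⟶ H`. -/
noncomputable abbrev imageRing {G H : ProalgebraicGroup.{u, v} k} (f : G ⟶ H) :
    Subalgebra k G.coordRing :=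
  (dual f : H.coordRing →ₐ[k] G.coordRing).range

lemma dual_comp_apply {G H K : ProalgebraicGroup.{u, v} k} (f : G ⟶ H) (g : H ⟶ K)
    (a : K.coordRing) : dual (f ≫ g) a = dual f (dual g a) := rfl

lemma hom_ext {G H : ProalgebraicGroup.{u, v} k} {f g : G ⟶ H} (h : ∀ a, dual f a = dual g a) :
    f = g :=
  Quiver.Hom.unop_inj (CommHopfAlgCat.hom_ext (BialgHom.ext h))

/-- The morphism with a given dual map. -/
def ofDual {G H : ProalgebraicGroup.{u, v} k} (f : H.coordRing →ₐc[k] G.coordRing) : G ⟶ H :=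
  Quiver.Hom.op (CommHopfAlgCat.ofHom f : H.unop ⟶ G.unop)

lemma IsEpimorphism.comp {G H K : ProalgebraicGroup.{u, v} k} {f : G ⟶ H} {g : H ⟶ K}
    (hf : IsEpimorphism f) (hg : IsEpimorphism g) : IsEpimorphism (f ≫ g) :=
  fun _ _ h => hg (hf h)

lemma IsEpimorphism.of_comp {G H K : ProalgebraicGroup.{u, v} k} {f : G ⟶ H} {g : H ⟶ K}
    (h : IsEpimorphism (f ≫ g)) : IsEpimorphism g :=
  Function.Injective.of_comp (f := dual f) h

lemma imageRing_comp_le {G H K : ProalgebraicGroup.{u, v} k} (f : G ⟶ H) (g : H ⟶ K) :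
    imageRing (f ≫ g) ≤ imageRing f := by
  rintro _ ⟨a, rfl⟩
  exact ⟨dual g a, rfl⟩

lemma imageRing_comp {G H K : ProalgebraicGroup.{u, v} k} (f : G ⟶ H) (g : H ⟶ K) :
    imageRing (f ≫ g) = (imageRing g).map (dual f : H.coordRing →ₐ[k] G.coordRing) :=
  AlgHom.range_comp (dual g : K.coordRing →ₐ[k] H.coordRing) (dual f : H.coordRing →ₐ[k] G.coordRing)

/-- A morphism factors through an epimorphism if its dual map does. -/
lemma IsEpimorphism.exists_factor {G Q H : ProalgebraicGroup.{u, v} k} {q : G ⟶ Q}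
    (hq : IsEpimorphism q) (h : G ⟶ H) (hr : imageRing h ≤ imageRing q) :
    ∃ f : Q ⟶ H, q ≫ f = h :=
  ⟨ofDual (BialgHom.factorOfInjective (dual q) hq (dual h) fun x => hr ⟨x, rfl⟩),
    hom_ext fun a => BialgHom.apply_factorOfInjective (dual q) hq (dual h) _ a⟩

lemma nonempty_iso_of_bijective {G H : ProalgebraicGroup.{u, v} k} (f : G ⟶ H)
    (hf : Function.Bijective (dual f)) : Nonempty (G ≅ H) :=
  ⟨(CommHopfAlgCat.isoMk (BialgEquiv.ofBijective (dual f) hf)).op⟩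

/-- An injective algebra homomorphism into `k[G]` whose image is a Hopf subalgebra defines a
quotient of `G`. -/
lemma exists_quotient_of_injective (G : ProalgebraicGroup.{u, v} k) {R : Type v} [CommRing R]
    [Algebra k R] (i : R →ₐ[k] G.coordRing) (hi : Function.Injective i)
    (hΔ : ∀ r, comul (R := k) (i r) ∈ (Algebra.TensorProduct.map i i).range)
    (hS : ∀ r, antipode k (i r) ∈ i.range) :
    ∃ (Q : ProalgebraicGroup.{u, v} k) (e : R ≃ₐ[k] Q.coordRing) (q : G ⟶ Q),
      ∀ r, dual q (e r) = i r :=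
  letI := HopfAlgebra.ofInjective i hi hΔ hS
  ⟨.op (.of k R), .refl, ofDual (H := .op (.of k R)) (HopfAlgebra.ofInjectiveHom i hi hΔ hS),
    fun _ => rfl⟩

/-- A Hopf subalgebra of `k[G]`. -/
structure IsHopfSubalgebra {G : ProalgebraicGroup.{u, v} k} (D : Subalgebra k G.coordRing) :
    Prop where
  comul_mem : D ≤ (Algebra.TensorProduct.map D.val D.val).range.comap (comulAlgHom k G.coordRing)
  antipode_mem : D ≤ D.comap (antipodeAlgHom k G.coordRing)

lemma _root_.Algebra.TensorProduct.map_map_apply {A B A' B' A'' B'' : Type*} [CommRing A]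
    [Algebra k A] [CommRing B] [Algebra k B] [CommRing A'] [Algebra k A'] [CommRing B']
    [Algebra k B'] [CommRing A''] [Algebra k A''] [CommRing B''] [Algebra k B'']
    (f : A →ₐ[k] A') (g : B →ₐ[k] B') (f' : A' →ₐ[k] A'') (g' : B' →ₐ[k] B'') (t : A ⊗[k] B) :
    Algebra.TensorProduct.map f' g' (Algebra.TensorProduct.map f g t) =
      Algebra.TensorProduct.map (f'.comp f) (g'.comp g) t :=
  congr($(Algebra.TensorProduct.map_comp f' f g' g) t).symm

lemma range_map_val_mono {A B : Type*} [CommRing A] [Algebra k A] [CommRing B] [Algebra k B]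
    {D E : Subalgebra k A} (h : D ≤ E) (f : A →ₐ[k] B) :
    (Algebra.TensorProduct.map (f.comp D.val) (f.comp D.val)).range ≤
      (Algebra.TensorProduct.map (f.comp E.val) (f.comp E.val)).range := by
  rintro _ ⟨t, rfl⟩
  refine ⟨Algebra.TensorProduct.map (Subalgebra.inclusion h) (Subalgebra.inclusion h) t, ?_⟩
  exact Algebra.TensorProduct.map_map_apply _ _ _ _ t

/-- Comultiplication and antipode are algebra homomorphisms, so each closure condition says that `D`
lies in the preimage of a subalgebra growing with `D`; such conditions pass to arbitrary joins. -/
lemma IsHopfSubalgebra.iSup {G : ProalgebraicGroup.{u, v} k} {J : Sort*}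
    {D : J → Subalgebra k G.coordRing} (h : ∀ j, IsHopfSubalgebra (D j)) :
    IsHopfSubalgebra (⨆ j, D j) where
  comul_mem := iSup_le fun j => (h j).comul_mem.trans <| (Subalgebra.gc_map_comap _).monotone_u <|
    range_map_val_mono (le_iSup D j) (.id k _)
  antipode_mem := iSup_le fun j => (h j).antipode_mem.trans <|
    (Subalgebra.gc_map_comap _).monotone_u (le_iSup D j)

lemma IsHopfSubalgebra.sup {G : ProalgebraicGroup.{u, v} k} {D E : Subalgebra k G.coordRing}
    (hD : IsHopfSubalgebra D) (hE : IsHopfSubalgebra E) : IsHopfSubalgebra (D ⊔ E) := by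
  rw [sup_eq_iSup]
  exact .iSup fun j => by cases j <;> assumption

lemma isHopfSubalgebra_imageRing {G H : ProalgebraicGroup.{u, v} k} (f : G ⟶ H) :
    IsHopfSubalgebra (imageRing f) where
  comul_mem := by
    rintro _ ⟨a, rfl⟩
    let g : H.coordRing →ₐ[k] imageRing f := (dual f : H.coordRing →ₐ[k] G.coordRing).rangeRestrict
    refine ⟨Algebra.TensorProduct.map g g (comul a), ?_⟩
    refine Eq.trans ?_ congr($(BialgHom.map_comp_comulAlgHom (dual f)) a)
    exact Algebra.TensorProduct.map_map_apply _ _ _ _ (comul a)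
  antipode_mem := by
    rintro _ ⟨a, rfl⟩
    exact ⟨antipode k a, BialgHom.map_antipode (dual f) a⟩

lemma isHopfSubalgebra_bot (G : ProalgebraicGroup.{u, v} k) :
    IsHopfSubalgebra (⊥ : Subalgebra k G.coordRing) := by
  simpa using IsHopfSubalgebra.iSup (G := G) (J := Empty) (D := fun _ => ⊥) (fun j => j.elim)

lemma isHopfSubalgebra_top (G : ProalgebraicGroup.{u, v} k) :
    IsHopfSubalgebra (⊤ : Subalgebra k G.coordRing) := by
  convert! isHopfSubalgebra_imageRing (𝟙 G)
  exact (AlgHom.range_eq_top _).mpr Function.surjective_id |>.symm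

/-- A Hopf subalgebra of `k[G]` is the coordinate ring of a quotient of `G`. -/
lemma IsHopfSubalgebra.exists_quotient {G : ProalgebraicGroup.{u, v} k}
    {D : Subalgebra k G.coordRing} (h : IsHopfSubalgebra D) :
    ∃ (Q : ProalgebraicGroup.{u, v} k) (q : G ⟶ Q), IsEpimorphism q ∧ imageRing q = D := by
  obtain ⟨Q, e, q, hq⟩ := G.exists_quotient_of_injective D.val Subtype.val_injective
    (fun r => h.comul_mem r.2) (fun r => ⟨⟨_, h.antipode_mem r.2⟩, rfl⟩)
  have hq' : (dual q : Q.coordRing →ₐ[k] G.coordRing).comp e.toAlgHom = D.val := AlgHom.ext hq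
  have hq'' (x : Q.coordRing) : dual q x = e.symm x := by
    rw [← D.val_apply, ← hq, e.apply_symm_apply]
  refine ⟨Q, q, fun x y hxy => ?_, ?_⟩
  · rw [hq'', hq''] at hxy
    exact e.symm.injective (Subtype.val_injective hxy)
  · refine le_antisymm ?_ ?_
    · rintro _ ⟨x, rfl⟩
      exact (hq'' x).symm ▸ (e.symm x).2
    · exact fun a ha => ⟨e ⟨a, ha⟩, hq ⟨a, ha⟩⟩

/-- A finitely generated Hopf subalgebra defines a coalgebraic subgroup. -/
def IsHopfSubalgebra.toCoalgebraicSubgroup {G : ProalgebraicGroup.{u, v} k}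
    {D : Subalgebra k G.coordRing} (h : IsHopfSubalgebra D) (hD : D.FG) :
    G.CoalgebraicSubgroup where
  quotientRing := D
  comul_mem _ ha := h.comul_mem ha
  antipode_mem _ ha := h.antipode_mem ha
  fg := hD

lemma CoalgebraicSubgroup.isHopfSubalgebra {G : ProalgebraicGroup.{u, v} k}
    (N : G.CoalgebraicSubgroup) : IsHopfSubalgebra N.quotientRing :=
  ⟨N.comul_mem, N.antipode_mem⟩

lemma isAlgebraic_iff_imageRing_fg {G Q : ProalgebraicGroup.{u, v} k} {q : G ⟶ Q}
    (hq : IsEpimorphism q) : Q.IsAlgebraic ↔ (imageRing q).FG :=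
  let e : Q.coordRing ≃ₐ[k] imageRing q := AlgEquiv.ofInjective _ hq
  ⟨fun h => Subalgebra.fg_iff_finiteType _ |>.mpr (Algebra.FiniteType.equiv h e),
    fun h => Algebra.FiniteType.equiv (Subalgebra.fg_iff_finiteType _ |>.mp h) e.symm⟩

end ProalgebraicGroup

/-! ### Projective limits and pro-`C`-groups -/

namespace ProalgebraicGroup

open TensorProduct Coalgebra Bialgebra HopfAlgebra

variable {k : Type u} [Field k]

section ProjectiveLimit

variable {I : Type v} [PartialOrder I]
  {G : I → ProalgebraicGroup.{u, v} k} {t : ∀ i j : I, i ≤ j → (G j ⟶ G i)}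
  {Γ : ProalgebraicGroup.{u, v} k} {p : ∀ i, Γ ⟶ G i}

/-- The projections define a compatible family of points over the join `U` of the images, hence a
map `k[Γ] → U`. Uniqueness over `k[Γ]` makes its composite with the inclusion the identity, so `U`
is everything. -/
lemma IsProjectiveLimit.iSup_imageRing (h : IsProjectiveLimit G t Γ p) :
    ⨆ i, imageRing (p i) = ⊤ := by
  set U := ⨆ i, imageRing (p i) with hU
  let x (i : I) : (G i).coordRing →ₐ[k] U :=
    (dual (p i) : (G i).coordRing →ₐ[k] Γ.coordRing).codRestrict U
      fun a => le_iSup (fun i => imageRing (p i)) i ⟨a, rfl⟩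
  have hp (i j : I) (hij : i ≤ j) (a) : dual (p j) (dual (t i j hij) a) = dual (p i) a := by
    rw [← dual_comp_apply, h.compatible]
  obtain ⟨y, hy, -⟩ := h.points U x fun i j hij => AlgHom.ext fun a => Subtype.ext (hp i j hij a)
  obtain ⟨z, -, hz⟩ := h.points Γ.coordRing (fun i => (dual (p i) : (G i).coordRing →ₐ[k] Γ.coordRing))
    fun i j hij => AlgHom.ext fun a => hp i j hij a
  have h1 : U.val.comp y = z := hz _ fun i => by
    have := congr(U.val.comp $(hy i))
    exact this
  have h2 : AlgHom.id k _ = z := hz _ fun i => rfl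
  refine eq_top_iff.mpr fun a _ => ?_
  have : U.val (y a) = a := congr($(h1.trans h2.symm) a)
  exact this ▸ (y a).2

variable [Nonempty I] [IsDirected I (· ≤ ·)]

/-- Test the limit on the direct limit of the `k[G i]`: the canonical map from `k[G i]` is injective
and factors through the dual of `p i`. -/
lemma IsProjectiveLimit.isEpimorphism (h : IsProjectiveLimit G t Γ p)
    (ht : ∀ i j hij, IsEpimorphism (t i j hij)) (i : I) : IsEpimorphism (p i) := by
  let f (i j : I) (hij : i ≤ j) : (G i).coordRing →ₐ[k] (G j).coordRing := dual (t i j hij)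
  have : DirectedSystem (fun i => (G i).coordRing) (f · · ·) :=
    { map_self := fun i x => by
        change dual (t i i le_rfl) x = x
        rw [h.map_id]; rfl
      map_map := fun _ _ _ hij hjl x => by
        change dual (t _ _ hjl) (dual (t _ _ hij) x) = dual (t _ _ _) x
        rw [← dual_comp_apply, h.map_comp] }
  obtain ⟨y, hy, -⟩ := h.points (DirectLimit (fun i => (G i).coordRing) f)
    (fun i => DirectLimit.Algebra.of _ f i)
    (fun i j hij => AlgHom.ext fun x => DirectLimit.Algebra.of_f (f := f) hij x)
  have hinj : Function.Injective (DirectLimit.Algebra.of _ f i) :=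
    DirectLimit.mk_injective (f := f) (fun i j hij => ht i j hij) i
  rw [← hy i] at hinj
  exact Function.Injective.of_comp (f := y) hinj

end ProjectiveLimit

lemma IsPro.exists_le {C : ProalgebraicGroup.{u, v} k → Prop} {Γ : ProalgebraicGroup.{u, v} k}
    (h : IsPro C Γ) {D : Subalgebra k Γ.coordRing} (hD : D.FG) :
    ∃ (Q : ProalgebraicGroup.{u, v} k) (q : Γ ⟶ Q),
      IsEpimorphism q ∧ C Q ∧ D ≤ imageRing q := by
  obtain ⟨I, _, G, t, p, _, _, hC, ht, hlim⟩ := h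
  obtain ⟨s, rfl⟩ := hD
  have hdir : Directed (· ≤ ·) fun i => imageRing (p i) :=
    directed_of_isDirected_le fun i j hij => by
      rw [← hlim.compatible i j hij]
      exact imageRing_comp_le _ _
  suffices ∃ i, (s : Set Γ.coordRing) ⊆ imageRing (p i) by
    obtain ⟨i, hi⟩ := this
    exact ⟨G i, p i, hlim.isEpimorphism ht i, hC i, Algebra.adjoin_le hi⟩
  refine Directed.exists_mem_subset_of_finset_subset_biUnion
    (f := fun i => (imageRing (p i) : Set Γ.coordRing)) hdir ?_
  rw [← Subalgebra.coe_iSup_of_directed hdir, hlim.iSup_imageRing]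
  exact Set.subset_univ _

/-- The finitely generated Hopf subalgebras form the projective system. By `h` they exhaust `k[Γ]`;
by `h'` each of their quotients is a quotient of a `C`-group, hence in `C`. -/
lemma isPro_of_exists_le {C : ProalgebraicGroup.{u, v} k → Prop} (hC : IsFormation C)
    {Γ : ProalgebraicGroup.{u, v} k}
    (h : ∀ D : Subalgebra k Γ.coordRing, D.FG → ∃ N : Γ.CoalgebraicSubgroup, D ≤ N.quotientRing)
    (h' : ∀ D : Subalgebra k Γ.coordRing, D.FG → ∃ (Q : ProalgebraicGroup.{u, v} k) (q : Γ ⟶ Q),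
      IsEpimorphism q ∧ C Q ∧ D ≤ imageRing q) : IsPro C Γ := by
  let I := {D : Subalgebra k Γ.coordRing // IsHopfSubalgebra D ∧ D.FG}
  choose Q q hq hqD using fun D : I => D.2.1.exists_quotient
  have hCQ (D : I) : C (Q D) := by
    obtain ⟨Q', q', hq', hCQ', hle⟩ := h' _ D.2.2
    obtain ⟨f, hf⟩ := hq'.exists_factor (q D) ((hqD D).trans_le hle)
    refine hC.quotient Q' (Q D) f (.of_comp (hf ▸ hq D)) ?_ hCQ'
    rw [isAlgebraic_iff_imageRing_fg (hq D), hqD]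
    exact D.2.2
  choose t ht using fun (i j : I) (hij : i ≤ j) =>
    (hq j).exists_factor (q i) (by rw [hqD, hqD]; exact hij)
  have cancel {D : I} {X : ProalgebraicGroup.{u, v} k} {f g : Q D ⟶ X}
      (hfg : q D ≫ f = q D ≫ g) : f = g :=
    hom_ext fun a => hq D congr(dual $hfg a)
  have hdir : IsDirected I (· ≤ ·) := ⟨fun D E =>
    ⟨⟨D.1 ⊔ E.1, D.2.1.sup E.2.1, D.2.2.sup E.2.2⟩,
      le_sup_left (a := D.1), le_sup_right (a := D.1)⟩⟩
  have hne : Nonempty I := ⟨⟨⊥, isHopfSubalgebra_bot Γ, Subalgebra.fg_bot⟩⟩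
  refine ⟨I, inferInstance, Q, t, q, hne, hdir, hCQ,
    fun i j hij => .of_comp ((ht i j hij).symm ▸ hq i), ?_⟩
  refine ⟨fun N => cancel (by simp [ht]), fun i j l hij hjl => cancel ?_, ht, ?_⟩
  · rw [← Category.assoc, ht, ht, ht]
  intro R _ _ x hx
  let K : I → Subalgebra k Γ.coordRing := Subtype.val
  have hK : Directed (· ≤ ·) K := directed_of_isDirected_le fun _ _ h => h
  have hKtop : ⊤ ≤ iSup K := fun a _ => by
    obtain ⟨N, hN⟩ := h (Algebra.adjoin k {a}) ⟨{a}, by simp⟩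
    exact le_iSup K ⟨N.quotientRing, N.isHopfSubalgebra, N.fg⟩
      (hN (Algebra.self_mem_adjoin_singleton k a))
  -- Identifying `K i` with `k[Q i]` turns the points `x i` into homomorphisms on a directed union
  -- of subalgebras, where they glue.
  let σ (i : I) : K i →ₐ[k] (Q i).coordRing :=
    AlgHom.factorOfInjective (dual (q i) : (Q i).coordRing →ₐ[k] Γ.coordRing) (hq i) (K i).val
      fun a => (hqD i).ge a.2
  have hσ (i : I) (a : K i) : dual (q i) (σ i a) = a :=
    AlgHom.apply_factorOfInjective (dual (q i) : (Q i).coordRing →ₐ[k] Γ.coordRing) (hq i) _ _ a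
  have hf (i j : I) (hij : K i ≤ K j) :
      (x i).comp (σ i) = ((x j).comp (σ j)).comp (Subalgebra.inclusion hij) := by
    refine AlgHom.ext fun a => ?_
    rw [← hx i j hij]
    refine congrArg (x j) (hq j ?_)
    refine Eq.trans ?_ (hσ j _).symm
    exact congr(dual $(ht i j hij) (σ i a)).trans (hσ i a)
  refine ⟨(Subalgebra.iSupLift K hK (fun i => (x i).comp (σ i)) hf ⊤ hKtop).comp
    Subalgebra.topEquiv.symm.toAlgHom, fun i => AlgHom.ext fun b => ?_, fun y hy => ?_⟩
  · have hb : dual (q i) b ∈ K i := (hqD i).le ⟨b, rfl⟩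
    refine (Subalgebra.iSupLift_mk (K := K) (dir := hK) (hf := hf) (hT := hKtop) (i := i)
      ⟨dual (q i) b, hb⟩ trivial).trans ?_
    exact congrArg (x i) (hq i (hσ i ⟨_, hb⟩))
  · refine AlgHom.ext fun a => ?_
    obtain ⟨i, hi⟩ := Set.mem_iUnion.mp
      ((Subalgebra.coe_iSup_of_directed hK).le (hKtop (Algebra.mem_top (x := a))))
    refine Eq.trans ?_ (Subalgebra.iSupLift_mk (K := K) (dir := hK) (hf := hf) (hT := hKtop)
      (i := i) ⟨a, hi⟩ trivial).symm
    refine Eq.trans ?_ congr($(hy i) (σ i ⟨a, hi⟩))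
    exact congrArg y (hσ i ⟨a, hi⟩).symm

end ProalgebraicGroup

/-! ### Neighborhood bases and rank -/

namespace ProalgebraicGroup

variable {k : Type u} [Field k]

/-- A family of coalgebraic subgroups of `G` whose coordinate rings `k[G/N]` generate `k[G]`, that
is, one with trivial intersection. -/
def Separates {G : ProalgebraicGroup.{u, v} k} {J : Type v} (N : J → G.CoalgebraicSubgroup) :
    Prop :=
  ⨆ j, (N j).quotientRing = ⊤

/-- The finite intersections of a family of coalgebraic subgroups are coalgebraic. -/
lemma exists_finset_inf {G : ProalgebraicGroup.{u, v} k} {J : Type v}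
    (N : J → G.CoalgebraicSubgroup) (s : Finset J) :
    ∃ M : G.CoalgebraicSubgroup, M.quotientRing = ⨆ j ∈ s, (N j).quotientRing := by
  classical
  refine ⟨IsHopfSubalgebra.toCoalgebraicSubgroup
    (.iSup fun j => .iSup fun _ => (N j).isHopfSubalgebra) ?_, rfl⟩
  induction s using Finset.induction with
  | empty => simpa using Subalgebra.fg_bot
  | insert a s _ ih =>
    rw [Finset.iSup_insert]
    exact (N a).fg.sup ih

/-- The finite intersections of a separating family form a neighborhood basis. -/
lemma Separates.exists_basis {G : ProalgebraicGroup.{u, v} k} {J : Type v}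
    {N : J → G.CoalgebraicSubgroup} (h : Separates N) :
    ∃ M : Finset J → G.CoalgebraicSubgroup, ∀ D : Subalgebra k G.coordRing, D.FG →
      ∃ s, D ≤ (M s).quotientRing := by
  classical
  choose M hM using exists_finset_inf N
  refine ⟨M, ?_⟩
  have hdir : Directed (· ≤ ·) fun s => (M s).quotientRing :=
    directed_of_isDirected_le fun s t hst => by
      rw [hM, hM]
      exact biSup_mono hst
  rintro _ ⟨s, rfl⟩
  obtain ⟨i, hi⟩ := Directed.exists_mem_subset_of_finset_subset_biUnion
    (f := fun s => ((M s).quotientRing : Set G.coordRing)) (s := s) hdir (by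
      rw [← Subalgebra.coe_iSup_of_directed hdir]
      have : ⨆ s, (M s).quotientRing = ⊤ := by
        refine eq_top_iff.mpr (h.ge.trans (iSup_le fun j => ?_))
        refine le_iSup_of_le {j} ?_
        rw [hM]
        simp
      rw [this]
      exact Set.subset_univ _)
  exact ⟨i, Algebra.adjoin_le hi⟩

lemma IsTrivial.rank_eq_zero {G : ProalgebraicGroup.{u, v} k} (h : G.IsTrivial) : G.rank = 0 :=
  if_pos h

lemma rank_le_mk {G : ProalgebraicGroup.{u, v} k} {S : Set G.CoalgebraicSubgroup}
    (hS : IsNeighborhoodBasis S) : G.rank ≤ Cardinal.mk S := by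
  rw [rank]
  split_ifs with h
  · exact zero_le
  · exact csInf_le' ⟨S, hS, rfl⟩

lemma isNeighborhoodBasis_univ (G : ProalgebraicGroup.{u, v} k) :
    IsNeighborhoodBasis (Set.univ : Set G.CoalgebraicSubgroup) :=
  fun N => ⟨N, trivial, le_refl N.quotientRing⟩

lemma exists_isNeighborhoodBasis_mk_eq_rank {G : ProalgebraicGroup.{u, v} k} (h : ¬ G.IsTrivial) :
    ∃ S : Set G.CoalgebraicSubgroup, IsNeighborhoodBasis S ∧ Cardinal.mk S = G.rank := by
  rw [rank, if_neg h]
  exact csInf_mem (s := {κ | ∃ S : Set G.CoalgebraicSubgroup, IsNeighborhoodBasis S ∧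
    Cardinal.mk S = κ}) ⟨_, _, isNeighborhoodBasis_univ G, rfl⟩

lemma rank_eq_zero_iff {G : ProalgebraicGroup.{u, v} k} : G.rank = 0 ↔ G.IsTrivial := by
  refine ⟨fun h => ?_, IsTrivial.rank_eq_zero⟩
  by_contra hG
  obtain ⟨S, hS, hcard⟩ := exists_isNeighborhoodBasis_mk_eq_rank hG
  rw [h, Cardinal.mk_eq_zero_iff] at hcard
  -- A neighborhood basis is never empty: `G` itself, with quotient ring `⊥`, must contain a member.
  obtain ⟨N, hN, -⟩ := hS ((isHopfSubalgebra_bot G).toCoalgebraicSubgroup Subalgebra.fg_bot)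
  exact hcard.elim ⟨N, hN⟩

lemma Separates.rank_le {G : ProalgebraicGroup.{u, v} k} {J : Type v}
    {N : J → G.CoalgebraicSubgroup} (h : Separates N) : G.rank ≤ Cardinal.mk (Finset J) := by
  obtain ⟨M, hM⟩ := h.exists_basis
  refine (rank_le_mk (S := Set.range M) fun N => ?_).trans Cardinal.mk_range_le
  obtain ⟨s, hs⟩ := hM _ N.fg
  exact ⟨_, ⟨s, rfl⟩, hs⟩

lemma _root_.Cardinal.mk_finset_lt {J : Type v} {κ : Cardinal.{v}} (hκ : Cardinal.aleph0 ≤ κ)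
    (hJ : Cardinal.mk J < κ) : Cardinal.mk (Finset J) < κ := by
  cases finite_or_infinite J
  · exact (Cardinal.lt_aleph0_of_finite _).trans_le hκ
  · rwa [Cardinal.mk_finset_of_infinite]

lemma Separates.rank_lt {G : ProalgebraicGroup.{u, v} k} {J : Type v}
    {N : J → G.CoalgebraicSubgroup} (h : Separates N) {κ : Cardinal.{v}}
    (hκ : Cardinal.aleph0 ≤ κ) (hJ : Cardinal.mk J < κ) : G.rank < κ :=
  h.rank_le.trans_lt (Cardinal.mk_finset_lt hκ hJ)

lemma IsAlgebraic.rank_le_one {G : ProalgebraicGroup.{u, v} k} (h : G.IsAlgebraic) :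
    G.rank ≤ 1 := by
  refine (rank_le_mk (S := {(isHopfSubalgebra_top G).toCoalgebraicSubgroup h.1}) fun N =>
    ⟨_, rfl, le_top (a := N.quotientRing)⟩).trans ?_
  simp

/-- A quotient of a pro-`C`-group that has a separating family of coalgebraic subgroups is a
pro-`C`-group. -/
lemma Separates.isPro {C : ProalgebraicGroup.{u, v} k → Prop} (hC : IsFormation C)
    {Γ G : ProalgebraicGroup.{u, v} k} (hΓ : IsPro C Γ) {q : Γ ⟶ G} (hq : IsEpimorphism q)
    {J : Type v} {N : J → G.CoalgebraicSubgroup} (h : Separates N) : IsPro C G := by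
  obtain ⟨M, hM⟩ := h.exists_basis
  refine isPro_of_exists_le hC (fun D hD => (hM D hD).imp' M fun _ => id) fun D hD => ?_
  obtain ⟨s, hs⟩ := hM D hD
  obtain ⟨Q, r, hr, hrM⟩ := (M s).isHopfSubalgebra.exists_quotient
  have hQ : Q.IsAlgebraic := (isAlgebraic_iff_imageRing_fg hr).mpr (hrM ▸ (M s).fg)
  -- Pulled back to `k[Γ]`, the ring of `Q` is finitely generated, so it lies in that of a
  -- `C`-quotient of `Γ`, and `Q` is a quotient of a `C`-group.
  obtain ⟨Q', q', hq', hCQ', hle⟩ :=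
    hΓ.exists_le ((isAlgebraic_iff_imageRing_fg (hq.comp hr)).mp hQ)
  obtain ⟨f, hf⟩ := hq'.exists_factor _ hle
  exact ⟨Q, r, hr, hC.quotient Q' Q f (.of_comp (hf ▸ hq.comp hr)) hQ hCQ', hrM ▸ hs⟩

/-- A basis only dominates Hopf subalgebras. The pro-`C` structure first encloses `D` in the ring of
a `C`-quotient, to which the basis property applies. -/
lemma IsPro.exists_mem_of_isNeighborhoodBasis {C : ProalgebraicGroup.{u, v} k → Prop}
    (hC : IsFormation C) {Γ : ProalgebraicGroup.{u, v} k} (hΓ : IsPro C Γ)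
    {S : Set Γ.CoalgebraicSubgroup} (hS : IsNeighborhoodBasis S) {D : Subalgebra k Γ.coordRing}
    (hD : D.FG) : ∃ N ∈ S, D ≤ N.quotientRing := by
  obtain ⟨Q, q, hq, hCQ, hle⟩ := hΓ.exists_le hD
  obtain ⟨N, hN, h⟩ := hS ((isHopfSubalgebra_imageRing q).toCoalgebraicSubgroup
    ((isAlgebraic_iff_imageRing_fg hq).mp (hC.isAlgebraic Q hCQ)))
  exact ⟨N, hN, hle.trans h⟩

/-- A pro-`C`-group of finite rank is algebraic. -/
lemma IsPro.isAlgebraic_of_rank_lt_aleph0 {C : ProalgebraicGroup.{u, v} k → Prop}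
    (hC : IsFormation C) {Γ : ProalgebraicGroup.{u, v} k} (hΓ : IsPro C Γ)
    (h : Γ.rank < Cardinal.aleph0) (hΓ' : ¬ Γ.IsTrivial) : Γ.IsAlgebraic := by
  obtain ⟨S, hS, hcard⟩ := exists_isNeighborhoodBasis_mk_eq_rank hΓ'
  have hfin : Finite S := Cardinal.lt_aleph0_iff_finite.mp (hcard.trans_lt h)
  have := Fintype.ofFinite S
  obtain ⟨M, hM⟩ := exists_finset_inf (fun N : S => N.1) Finset.univ
  have htop : M.quotientRing = ⊤ := eq_top_iff.mpr fun a _ => by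
    obtain ⟨N, hN, hle⟩ := hΓ.exists_mem_of_isNeighborhoodBasis hC hS
      (D := Algebra.adjoin k {a}) ⟨{a}, by simp⟩
    rw [hM]
    exact le_iSup₂_of_le (f := fun (j : S) (_ : j ∈ Finset.univ) => j.1.quotientRing) ⟨N, hN⟩
      (Finset.mem_univ _) hle (Algebra.self_mem_adjoin_singleton k a)
  exact ⟨htop ▸ M.fg⟩

lemma IsPro.mem_of_isAlgebraic {C : ProalgebraicGroup.{u, v} k → Prop} (hC : IsFormation C)
    {Γ : ProalgebraicGroup.{u, v} k} (hΓ : IsPro C Γ) (h : Γ.IsAlgebraic) : C Γ := by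
  obtain ⟨Q, q, hq, hCQ, hle⟩ := hΓ.exists_le h.1
  refine hC.of_iso Q Γ ?_ hCQ
  obtain ⟨e⟩ := nonempty_iso_of_bijective q ⟨hq, fun a => hle (Algebra.mem_top (x := a))⟩
  exact ⟨e.symm⟩

lemma isPro_of_mem {C : ProalgebraicGroup.{u, v} k → Prop} (hC : IsFormation C)
    {G : ProalgebraicGroup.{u, v} k} (hG : C G) : IsPro C G :=
  isPro_of_exists_le hC
    (fun _ _ => ⟨(isHopfSubalgebra_top G).toCoalgebraicSubgroup (hC.isAlgebraic G hG).1, le_top⟩)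
    fun _ _ => ⟨G, 𝟙 G, Function.injective_id, hG, fun a _ => ⟨a, rfl⟩⟩

end ProalgebraicGroup

/-! ### Finitely generated algebras containing their tensor square -/

section Algebra

open TensorProduct

variable {k : Type u} [Field k] {A : Type v} [CommRing A] [Algebra k A]

/-- Adding a variable tensors with `k[X]`: `g` and `X ↦ x` embed the result in `A ⊗ A`, and `f`
brings it back to `A`. -/
lemma exists_mvPolynomial_injective_of_tensorProduct (f : A ⊗[k] A →ₐ[k] A)
    (hf : Function.Injective f) {x : A} (hx : Transcendental k x) (n : ℕ) :
    ∃ g : MvPolynomial (Fin n) k →ₐ[k] A, Function.Injective g := by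
  have : Nontrivial A := ⟨x, 0, fun h => hx (h ▸ isAlgebraic_zero)⟩
  induction n with
  | zero =>
    exact ⟨(Algebra.ofId k A).comp (MvPolynomial.isEmptyAlgEquiv k (Fin 0)).toAlgHom,
      (FaithfulSMul.algebraMap_injective k A).comp (MvPolynomial.isEmptyAlgEquiv k (Fin 0)).injective⟩
  | succ n ih =>
    obtain ⟨g, hg⟩ := ih
    have hx' : Function.Injective (Polynomial.aeval (R := k) x) :=
      transcendental_iff_injective.mp hx
    refine ⟨(f.comp (Algebra.TensorProduct.map g (Polynomial.aeval x))).comp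
      ((polyEquivTensor k (MvPolynomial (Fin n) k)).toAlgHom.comp
        ((MvPolynomial.finSuccEquiv k n).toAlgHom)), ?_⟩
    exact (hf.comp (Algebra.TensorProduct.map_injective_of_field hg hx')).comp
      ((polyEquivTensor k (MvPolynomial (Fin n) k)).injective.comp
        (MvPolynomial.finSuccEquiv k n).injective)

/-- A nonzero finitely generated algebra `A` over a field with an embedding `A ⊗ A → A` is the
base field. -/
lemma Algebra.FiniteType.algebraMap_bijective_of_tensorProduct [Nontrivial A]
    [Algebra.FiniteType k A] (f : A ⊗[k] A →ₐ[k] A) (hf : Function.Injective f) :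
    Function.Bijective (algebraMap k A) := by
  -- If `A` is algebraic, its dimension `d > 0` is finite and `d * d ≤ d` forces `d = 1`. Otherwise
  -- `A` contains polynomial rings in arbitrarily many variables, contradicting finite transcendence
  -- degree.
  by_cases halg : Algebra.IsAlgebraic k A
  · have := Algebra.IsIntegral.finite (R := k) (A := A)
    have h1 := LinearMap.finrank_le_finrank_of_injective (f := f.toLinearMap) hf
    rw [Module.finrank_tensorProduct] at h1
    have h2 : 0 < Module.finrank k A := Module.finrank_pos
    have h3 : Module.finrank k A = 1 := by nlinarith
    exact Algebra.finrank_eq_one_iff_bijective_algebraMap.mp h3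
  · obtain ⟨x, hx⟩ : ∃ x : A, Transcendental k x := by
      by_contra! h
      exact halg ⟨fun x => not_not.mp (h x)⟩
    have hfin := trdeg_lt_aleph0_of_finiteType (R := k) (S := A)
    obtain ⟨n, hn⟩ := Cardinal.lt_aleph0.mp hfin
    obtain ⟨g, hg⟩ := exists_mvPolynomial_injective_of_tensorProduct f hf hx (n + 1)
    have := lift_trdeg_le_of_injective g hg
    rw [MvPolynomial.trdeg_of_isDomain, hn] at this
    simp at this

end Algebra

/-! ### Nontrivial saturated groups have infinite rank -/

namespace ProalgebraicGroup

open TensorProduct Coalgebra Bialgebra HopfAlgebra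

variable {k : Type u} [Field k]

/-- A trivial quotient. -/
lemma exists_trivial_quotient (G : ProalgebraicGroup.{u, v} k) :
    ∃ (H : ProalgebraicGroup.{u, v} k) (q : G ⟶ H), IsEpimorphism q ∧ H.IsTrivial := by
  obtain ⟨H, q, hq, h⟩ := (isHopfSubalgebra_bot G).exists_quotient
  refine ⟨H, q, hq, Bialgebra.algebraMap_injective _, fun x => ?_⟩
  obtain ⟨c, hc⟩ : dual q x ∈ (⊥ : Subalgebra k G.coordRing) := h.le ⟨x, rfl⟩
  exact ⟨c, hq ((AlgHomClass.commutes (dual q) c).trans hc)⟩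

/-- The direct product `G × G`. -/
lemma exists_prod_self (G : ProalgebraicGroup.{u, v} k) :
    ∃ (P : ProalgebraicGroup.{u, v} k) (p₁ p₂ : P ⟶ G) (e : G.coordRing ⊗[k] G.coordRing ≃ₐ[k]
      P.coordRing), (∀ a, dual p₁ a = e (a ⊗ₜ 1)) ∧ ∀ a, dual p₂ a = e (1 ⊗ₜ a) := by
  let A := G.coordRing
  let i₁ : A →ₐc[k] A ⊗[k] A := (Bialgebra.TensorProduct.map (.id k A) (unitBialgHom k A)).comp
    (Bialgebra.TensorProduct.rid k k A).symm
  let i₂ : A →ₐc[k] A ⊗[k] A := (Bialgebra.TensorProduct.map (unitBialgHom k A) (.id k A)).comp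
    (Bialgebra.TensorProduct.lid k A).symm
  refine ⟨.op (.of k (A ⊗[k] A)), ofDual (G := .op (.of k (A ⊗[k] A))) i₁,
    ofDual (G := .op (.of k (A ⊗[k] A))) i₂, .refl, fun a => ?_, fun a => ?_⟩
  · change a ⊗ₜ algebraMap k A 1 = a ⊗ₜ 1
    rw [map_one]
  · change algebraMap k A 1 ⊗ₜ a = 1 ⊗ₜ a
    rw [map_one]

/-- A saturated pro-`C`-group that is algebraic is trivial. -/
lemma IsSaturated.isTrivial_of_isAlgebraic {C : ProalgebraicGroup.{u, v} k → Prop}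
    (hC : IsFormation C) {Γ : ProalgebraicGroup.{u, v} k} (hΓ : IsSaturated C Γ)
    (h : Γ.IsAlgebraic) : Γ.IsTrivial := by
  by_contra htriv
  have : Nontrivial Γ.coordRing := Bialgebra.nontrivial (R := k)
  have : Algebra.FiniteType k Γ.coordRing := h
  have hrank : 1 ≤ Γ.rank :=
    Cardinal.one_le_iff_ne_zero.mpr (mt rank_eq_zero_iff.mp htriv)
  have hCΓ := hΓ.1.mem_of_isAlgebraic hC h
  obtain ⟨P, p₁, p₂, e, h₁, h₂⟩ := exists_prod_self Γ
  have hp₁ : IsEpimorphism p₁ := fun a b hab => by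
    rw [h₁, h₁] at hab
    exact Algebra.TensorProduct.includeLeft_injective (S := k)
      (FaithfulSMul.algebraMap_injective k Γ.coordRing) (e.injective hab)
  have hp₂ : IsEpimorphism p₂ := fun a b hab => by
    rw [h₂, h₂] at hab
    exact Algebra.TensorProduct.includeRight_injective
      (FaithfulSMul.algebraMap_injective k Γ.coordRing) (e.injective hab)
  have hCP : C P := by
    refine hC.subdirect P Γ Γ p₁ p₂ ?_ hp₁ hp₂ hCΓ hCΓ
    have : Algebra.TensorProduct.productMap (dual p₁ : Γ.coordRing →ₐ[k] P.coordRing)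
        (dual p₂ : Γ.coordRing →ₐ[k] P.coordRing) = e.toAlgHom := by
      ext a
      · simpa using h₁ a
      · simpa using h₂ a
    rw [this]
    exact e.surjective
  -- Over the trivial group the lifting condition is vacuous, so saturation simply provides an
  -- epimorphism `Γ ↠ Γ × Γ`.
  obtain ⟨H, q, hq, hH⟩ := exists_trivial_quotient Γ
  obtain ⟨φ, hφ, -⟩ := hΓ.2 P H (p₁ ≫ q) q (hp₁.comp hq) hq (isPro_of_mem hC hCP)
    (by rw [hH.rank_eq_zero]; exact zero_lt_one.trans_le hrank)
    ((hC.isAlgebraic P hCP).rank_le_one.trans hrank)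
  exact htriv (Algebra.FiniteType.algebraMap_bijective_of_tensorProduct
    ((dual φ : P.coordRing →ₐ[k] Γ.coordRing).comp e.toAlgHom) (Function.Injective.comp (g := dual φ) hφ e.injective))

/-- The rank of a nontrivial saturated pro-`C`-group is infinite. -/
lemma IsSaturated.aleph0_le_rank {C : ProalgebraicGroup.{u, v} k → Prop}
    (hC : IsFormation C) {Γ : ProalgebraicGroup.{u, v} k} (hΓ : IsSaturated C Γ)
    (h : ¬ Γ.IsTrivial) : Cardinal.aleph0 ≤ Γ.rank := by
  by_contra! hlt
  exact h (hΓ.isTrivial_of_isAlgebraic hC (hΓ.1.isAlgebraic_of_rank_lt_aleph0 hC hlt h))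

end ProalgebraicGroup

/-! ### Correspondences between `Γ` and `Γ'` -/

namespace ProalgebraicGroup

open TensorProduct Coalgebra Bialgebra HopfAlgebra

variable {k : Type u} [Field k] {Γ Γ' : ProalgebraicGroup.{u, v} k}

/-- The algebra homomorphism `k[Q] → k[Γ] × k[Γ']` of a pair of morphisms `Γ ⟶ Q` and `Γ' ⟶ Q`. -/
noncomputable abbrev dualPair {Q : ProalgebraicGroup.{u, v} k} (f : Γ ⟶ Q) (g : Γ' ⟶ Q) :
    Q.coordRing →ₐ[k] Γ.coordRing × Γ'.coordRing :=
  (dual f : Q.coordRing →ₐ[k] Γ.coordRing).prod (dual g : Q.coordRing →ₐ[k] Γ'.coordRing)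

/-- A subalgebra of `k[Γ] × k[Γ']` that is closed under the Hopf algebra operations, taken
componentwise. -/
structure IsHopfCorrespondence (R : Subalgebra k (Γ.coordRing × Γ'.coordRing)) : Prop where
  comul_mem : R ≤ (AlgHom.prod
    (Algebra.TensorProduct.map ((AlgHom.fst k _ _).comp R.val) ((AlgHom.fst k _ _).comp R.val))
    (Algebra.TensorProduct.map ((AlgHom.snd k _ _).comp R.val)
      ((AlgHom.snd k _ _).comp R.val))).range.comap
    (((comulAlgHom k Γ.coordRing).comp (AlgHom.fst k _ _)).prod
      ((comulAlgHom k Γ'.coordRing).comp (AlgHom.snd k _ _)))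
  antipode_mem : R ≤ R.comap (((antipodeAlgHom k Γ.coordRing).comp (AlgHom.fst k _ _)).prod
      ((antipodeAlgHom k Γ'.coordRing).comp (AlgHom.snd k _ _)))
  counit_eq : R ≤ AlgHom.equalizer ((counitAlgHom k Γ.coordRing).comp (AlgHom.fst k _ _))
    ((counitAlgHom k Γ'.coordRing).comp (AlgHom.snd k _ _))

/-- Both projections of `R ⊆ k[Γ] × k[Γ']` are injective. -/
structure IsBiinjective (R : Subalgebra k (Γ.coordRing × Γ'.coordRing)) : Prop where
  eq_zero_of_fst : ∀ r ∈ R, r.1 = 0 → r = 0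
  eq_zero_of_snd : ∀ r ∈ R, r.2 = 0 → r = 0

lemma IsBiinjective.mono {R T : Subalgebra k (Γ.coordRing × Γ'.coordRing)} (h : IsBiinjective R)
    (hT : T ≤ R) : IsBiinjective T :=
  ⟨fun r hr => h.1 r (hT hr), fun r hr => h.2 r (hT hr)⟩

lemma isBiinjective_bot : IsBiinjective (⊥ : Subalgebra k (Γ.coordRing × Γ'.coordRing)) := by
  constructor
  · rintro _ ⟨c, rfl⟩ h
    have : c = 0 := (Bialgebra.algebraMap_injective (R := k) Γ.coordRing) (h.trans (map_zero _).symm)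
    subst this
    exact map_zero _
  · rintro _ ⟨c, rfl⟩ h
    have : c = 0 := (Bialgebra.algebraMap_injective (R := k) Γ'.coordRing) (h.trans (map_zero _).symm)
    subst this
    exact map_zero _

/-- In a directed join every element already lies in one member; an empty join consists of scalars.
-/
lemma IsBiinjective.iSup {J : Type*} {R : J → Subalgebra k (Γ.coordRing × Γ'.coordRing)}
    (hdir : Directed (· ≤ ·) R) (h : ∀ j, IsBiinjective (R j)) : IsBiinjective (⨆ j, R j) := by
  cases isEmpty_or_nonempty J
  · rw [iSup_of_empty]
    exact isBiinjective_bot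
  have hmem {r} (hr : r ∈ ⨆ j, R j) : ∃ j, r ∈ R j :=
    Set.mem_iUnion.mp ((Subalgebra.coe_iSup_of_directed hdir).le hr)
  exact ⟨fun r hr => (hmem hr).elim fun j hj => (h j).1 r hj,
    fun r hr => (hmem hr).elim fun j hj => (h j).2 r hj⟩

/-- This is how biinjectivity is preserved: an enlarged correspondence is placed inside the graph of
a common quotient. -/
lemma isBiinjective_range_dualPair {Q : ProalgebraicGroup.{u, v} k} {f : Γ ⟶ Q} {g : Γ' ⟶ Q}
    (hf : IsEpimorphism f) (hg : IsEpimorphism g) : IsBiinjective (dualPair f g).range := by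
  constructor
  · rintro _ ⟨a, rfl⟩ h
    have : a = 0 := hf (h.trans (map_zero (dual f)).symm)
    subst this
    exact map_zero _
  · rintro _ ⟨a, rfl⟩ h
    have : a = 0 := hg (h.trans (map_zero (dual g)).symm)
    subst this
    exact map_zero _

lemma IsHopfCorrespondence.iSup {J : Sort*} {R : J → Subalgebra k (Γ.coordRing × Γ'.coordRing)}
    (h : ∀ j, IsHopfCorrespondence (R j)) : IsHopfCorrespondence (⨆ j, R j) where
  comul_mem := iSup_le fun j => (h j).comul_mem.trans <| (Subalgebra.gc_map_comap _).monotone_u <| by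
    rintro _ ⟨t, rfl⟩
    let ι := Subalgebra.inclusion (le_iSup R j)
    exact ⟨Algebra.TensorProduct.map ι ι t, Prod.ext
      (Algebra.TensorProduct.map_map_apply ι ι _ _ t) (Algebra.TensorProduct.map_map_apply ι ι _ _ t)⟩
  antipode_mem := iSup_le fun j => (h j).antipode_mem.trans <|
    (Subalgebra.gc_map_comap _).monotone_u (le_iSup R j)
  counit_eq := iSup_le fun j => (h j).counit_eq

lemma IsHopfCorrespondence.sup {R T : Subalgebra k (Γ.coordRing × Γ'.coordRing)}
    (hR : IsHopfCorrespondence R) (hT : IsHopfCorrespondence T) : IsHopfCorrespondence (R ⊔ T) := by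
  rw [sup_eq_iSup]
  exact .iSup fun j => by cases j <;> assumption

lemma isHopfCorrespondence_range_dualPair {Q : ProalgebraicGroup.{u, v} k} (f : Γ ⟶ Q)
    (g : Γ' ⟶ Q) : IsHopfCorrespondence (dualPair f g).range where
  comul_mem := by
    rintro _ ⟨a, rfl⟩
    let ρ := (dualPair f g).rangeRestrict
    refine ⟨Algebra.TensorProduct.map ρ ρ (comul a), Prod.ext ?_ ?_⟩
    · exact (Algebra.TensorProduct.map_map_apply ρ ρ _ _ (comul a)).trans
        congr($(BialgHom.map_comp_comulAlgHom (dual f)) a)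
    · exact (Algebra.TensorProduct.map_map_apply ρ ρ _ _ (comul a)).trans
        congr($(BialgHom.map_comp_comulAlgHom (dual g)) a)
  antipode_mem := by
    rintro _ ⟨a, rfl⟩
    exact ⟨antipode k a, Prod.ext (BialgHom.map_antipode (dual f) a)
      (BialgHom.map_antipode (dual g) a)⟩
  counit_eq := by
    rintro _ ⟨a, rfl⟩
    exact congr($(BialgHom.counitAlgHom_comp (dual f)) a).trans
      congr($(BialgHom.counitAlgHom_comp (dual g)) a).symm

/-- A correspondence with injective projections is the graph of an isomorphism between quotients
of `Γ` and `Γ'`. -/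
lemma IsHopfCorrespondence.exists_common_quotient
    {R : Subalgebra k (Γ.coordRing × Γ'.coordRing)} (h : IsHopfCorrespondence R)
    (hR : IsBiinjective R) :
    ∃ (P : ProalgebraicGroup.{u, v} k) (p : Γ ⟶ P) (p' : Γ' ⟶ P),
      IsEpimorphism p ∧ IsEpimorphism p' ∧ (dualPair p p').range = R := by
  let i : R →ₐ[k] Γ.coordRing := (AlgHom.fst k _ _).comp R.val
  let j : R →ₐ[k] Γ'.coordRing := (AlgHom.snd k _ _).comp R.val
  have hi : Function.Injective i := (injective_iff_map_eq_zero i).mpr fun r hr =>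
    Subtype.ext (hR.1 r r.2 hr)
  have hj : Function.Injective j := (injective_iff_map_eq_zero j).mpr fun r hr =>
    Subtype.ext (hR.2 r r.2 hr)
  -- A single tensor `t` induces both comultiplications, which is what makes the passage from one
  -- projection to the other compatible with them.
  have hΔ (r : R) : ∃ t : R ⊗[k] R, Algebra.TensorProduct.map i i t = comul (i r) ∧
      Algebra.TensorProduct.map j j t = comul (j r) := by
    obtain ⟨t, ht⟩ := h.comul_mem r.2
    exact ⟨t, congr(($ht).1), congr(($ht).2)⟩
  obtain ⟨P, e, p, hp⟩ := Γ.exists_quotient_of_injective i hi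
    (fun r => (hΔ r).imp fun t ht => ht.1) (fun r => ⟨⟨_, h.antipode_mem r.2⟩, rfl⟩)
  have hpe : (dual p : P.coordRing →ₐ[k] Γ.coordRing).comp e.toAlgHom = i := AlgHom.ext hp
  have hepi : IsEpimorphism p := fun x y hxy => by
    rw [← e.apply_symm_apply x, ← e.apply_symm_apply y, hp, hp] at hxy
    exact e.symm.injective (hi hxy)
  -- `k[P]` is `R` with the structure coming from `Γ`; it remains to see that the second projection
  -- respects that structure.
  let φ : P.coordRing →ₐ[k] Γ'.coordRing := j.comp e.symm.toAlgHom
  have hφe : φ.comp e.toAlgHom = j := AlgHom.ext fun r => congrArg j (e.symm_apply_apply r)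
  have hφ (r : R) : φ (e r) = j r := congr($hφe r)
  have hcounit : (counitAlgHom k _).comp φ = counitAlgHom k P.coordRing := by
    refine AlgHom.ext fun x => ?_
    obtain ⟨r, rfl⟩ := e.surjective x
    rw [← BialgHom.counitAlgHom_comp (dual p)]
    change counit (φ (e r)) = counit (dual p (e r))
    rw [hφ, hp]
    exact (h.counit_eq r.2).symm
  have hcomul : (Algebra.TensorProduct.map φ φ).comp (comulAlgHom k _) = (comulAlgHom k _).comp φ := by
    refine AlgHom.ext fun x => ?_
    obtain ⟨r, rfl⟩ := e.surjective x
    obtain ⟨t, ht, ht'⟩ := hΔ r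
    have key : comul (R := k) (e r) = Algebra.TensorProduct.map e.toAlgHom e.toAlgHom t := by
      refine Algebra.TensorProduct.map_injective_of_field
        (f := (dual p : P.coordRing →ₐ[k] Γ.coordRing))
        (g := (dual p : P.coordRing →ₐ[k] Γ.coordRing)) hepi hepi ?_
      rw [Algebra.TensorProduct.map_map_apply, hpe, ht]
      exact congr($(BialgHom.map_comp_comulAlgHom (dual p)) (e r)).trans congr(comul $(hp r))
    change Algebra.TensorProduct.map φ φ (comul (e r)) = comul (φ (e r))
    rw [key, Algebra.TensorProduct.map_map_apply, hφe, ht', hφ]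
  let p' : Γ' ⟶ P := ofDual (BialgHom.ofAlgHom φ hcounit hcomul)
  refine ⟨P, p, p', hepi, fun x y hxy => e.symm.injective (hj hxy), le_antisymm ?_ ?_⟩
  · rintro _ ⟨x, rfl⟩
    obtain ⟨r, rfl⟩ := e.surjective x
    exact (Prod.ext (hp r) (hφ r) : dualPair p p' (e r) = r.1) ▸ r.2
  · exact fun r hr => ⟨e ⟨r, hr⟩, Prod.ext (hp ⟨r, hr⟩) (hφ ⟨r, hr⟩)⟩

lemma map_fst_range_dualPair {Q : ProalgebraicGroup.{u, v} k} (f : Γ ⟶ Q) (g : Γ' ⟶ Q) :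
    (dualPair f g).range.map (AlgHom.fst k _ _) = imageRing f :=
  (AlgHom.range_comp _ _).symm

lemma map_snd_range_dualPair {Q : ProalgebraicGroup.{u, v} k} (f : Γ ⟶ Q) (g : Γ' ⟶ Q) :
    (dualPair f g).range.map (AlgHom.snd k _ _) = imageRing g :=
  (AlgHom.range_comp _ _).symm

lemma range_dualPair_comp_le {P Q : ProalgebraicGroup.{u, v} k} (f : Γ ⟶ P) (g : Γ' ⟶ P)
    (h : P ⟶ Q) : (dualPair (f ≫ h) (g ≫ h)).range ≤ (dualPair f g).range := by
  rintro _ ⟨a, rfl⟩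
  exact ⟨dual h a, rfl⟩

lemma range_dualPair_fg {Q : ProalgebraicGroup.{u, v} k} (f : Γ ⟶ Q) (g : Γ' ⟶ Q)
    (hQ : Q.IsAlgebraic) : (dualPair f g).range.FG := by
  rw [← Algebra.map_top]
  exact hQ.1.map _

lemma _root_.Subalgebra.map_iSup' {A B : Type*} [CommRing A] [Algebra k A] [CommRing B]
    [Algebra k B] (f : A →ₐ[k] B) {J : Sort*} (D : J → Subalgebra k A) :
    (⨆ j, D j).map f = ⨆ j, (D j).map f :=
  (Subalgebra.gc_map_comap f).l_iSup

/-- The preimage of a coalgebraic subgroup is coalgebraic. -/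
lemma CoalgebraicSubgroup.exists_preimage {G P : ProalgebraicGroup.{u, v} k} (a : G ⟶ P)
    (N : P.CoalgebraicSubgroup) : ∃ M : G.CoalgebraicSubgroup,
      M.quotientRing = N.quotientRing.map (dual a : P.coordRing →ₐ[k] G.coordRing) := by
  obtain ⟨Q, q, -, hqN⟩ := N.isHopfSubalgebra.exists_quotient
  refine ⟨(isHopfSubalgebra_imageRing (a ≫ q)).toCoalgebraicSubgroup ?_, ?_⟩
  · rw [imageRing_comp, hqN]
    exact N.fg.map _
  · exact (imageRing_comp a q).trans (by rw [hqN])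

/-- Each `T j` is the graph of an algebraic quotient of `P`, and these generate `k[P]`. Keeping the
index type `J` bounds the rank of `P`, including at limit stages. -/
lemma exists_common_quotient_separates {J : Type v}
    {T : J → Subalgebra k (Γ.coordRing × Γ'.coordRing)}
    (hT : ∀ j, IsHopfCorrespondence (T j)) (hfg : ∀ j, (T j).FG)
    (hR : IsBiinjective (⨆ j, T j)) :
    ∃ (P : ProalgebraicGroup.{u, v} k) (p : Γ ⟶ P) (p' : Γ' ⟶ P) (N : J → P.CoalgebraicSubgroup),
      IsEpimorphism p ∧ IsEpimorphism p' ∧ (dualPair p p').range = ⨆ j, T j ∧ Separates N := by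
  obtain ⟨P, p, p', hp, hp', hrange⟩ :=
    (IsHopfCorrespondence.iSup hT).exists_common_quotient hR
  choose Q q q' hq hq' hqT using fun j => (hT j).exists_common_quotient (hR.mono (le_iSup T j))
  have himage (j : J) : imageRing (q j) = (T j).map (AlgHom.fst k _ _) := by
    rw [← hqT j, map_fst_range_dualPair]
  have himage' : imageRing p = (⨆ j, T j).map (AlgHom.fst k _ _) := by
    rw [← hrange, map_fst_range_dualPair]
  choose f hf using fun j => hp.exists_factor (q j) (by
    rw [himage, himage']
    exact Subalgebra.map_mono (le_iSup T j))
  have hfepi (j : J) : IsEpimorphism (f j) := .of_comp ((hf j).symm ▸ hq j)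
  have hQ (j : J) : (Q j).IsAlgebraic := by
    rw [isAlgebraic_iff_imageRing_fg (hq j), himage]
    exact (hfg j).map _
  refine ⟨P, p, p', fun j => (isHopfSubalgebra_imageRing (f j)).toCoalgebraicSubgroup
    ((isAlgebraic_iff_imageRing_fg (hfepi j)).mp (hQ j)), hp, hp', hrange, ?_⟩
  apply Subalgebra.map_injective (f := (dual p : P.coordRing →ₐ[k] Γ.coordRing)) hp
  rw [Subalgebra.map_iSup', Algebra.map_top]
  refine Eq.trans (iSup_congr fun j => ?_) ((Subalgebra.map_iSup' _ _).symm.trans himage'.symm)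
  exact (imageRing_comp p (f j)).symm.trans (by rw [hf, himage])

/-! ### Back-and-forth -/

/-- An isomorphism between quotients of small rank of `Γ` and of the saturated group `Γ'` extends to
a quotient of `Γ` on which a given coalgebraic subgroup acts trivially. -/
lemma IsSaturated.exists_extension {C : ProalgebraicGroup.{u, v} k → Prop} (hC : IsFormation C)
    (hΓ : IsPro C Γ) (hΓ' : IsSaturated C Γ') (hκ : Cardinal.aleph0 ≤ Γ'.rank)
    {P : ProalgebraicGroup.{u, v} k} {p : Γ ⟶ P} {p' : Γ' ⟶ P} (hp : IsEpimorphism p)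
    (hp' : IsEpimorphism p') {J : Type v} {N : J → P.CoalgebraicSubgroup} (hN : Separates N)
    (hJ : Cardinal.mk J < Γ'.rank) (B : Γ.CoalgebraicSubgroup) :
    ∃ (G Q : ProalgebraicGroup.{u, v} k) (f : Γ ⟶ G) (g : Γ' ⟶ G) (a : G ⟶ P) (b : G ⟶ Q),
      IsEpimorphism f ∧ IsEpimorphism g ∧ f ≫ a = p ∧ g ≫ a = p' ∧ Q.IsAlgebraic ∧
        imageRing (f ≫ b) = B.quotientRing := by
  obtain ⟨Q, q, hq, hqB⟩ := B.isHopfSubalgebra.exists_quotient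
  have hQ : Q.IsAlgebraic := by
    rw [isAlgebraic_iff_imageRing_fg hq, hqB]
    exact B.fg
  -- `G` is the smallest quotient of `Γ` dominating both `P` and `Γ/B`. One index added to `J`
  -- suffices to separate it, so its rank stays below that of `Γ'`.
  obtain ⟨G, f, hf, hfG⟩ :=
    ((isHopfSubalgebra_imageRing p).sup (isHopfSubalgebra_imageRing q)).exists_quotient
  obtain ⟨a, ha⟩ := hf.exists_factor p (hfG ▸ le_sup_left)
  obtain ⟨b, hb⟩ := hf.exists_factor q (hfG ▸ le_sup_right)
  have haepi : IsEpimorphism a := .of_comp (ha.symm ▸ hp)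
  have hbepi : IsEpimorphism b := .of_comp (hb.symm ▸ hq)
  choose M hM using fun j => (N j).exists_preimage a
  let Mb : G.CoalgebraicSubgroup := (isHopfSubalgebra_imageRing b).toCoalgebraicSubgroup
    ((isAlgebraic_iff_imageRing_fg hbepi).mp hQ)
  let M' : Option J → G.CoalgebraicSubgroup := fun o => o.elim Mb M
  have hM' : Separates M' := by
    have h1 : ⨆ j, (M j).quotientRing = imageRing a := by
      rw [iSup_congr hM, ← Subalgebra.map_iSup', hN, Algebra.map_top]
    have h2 : ⨆ o, (M' o).quotientRing = imageRing b ⊔ imageRing a := by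
      rw [iSup_option, ← h1]
      rfl
    refine h2.trans ?_
    apply Subalgebra.map_injective (f := (dual f : G.coordRing →ₐ[k] Γ.coordRing)) hf
    rw [Algebra.map_sup, ← imageRing_comp, ← imageRing_comp, ha, hb, sup_comm, ← hfG,
      Algebra.map_top]
  have hG : G.rank < Γ'.rank := hM'.rank_lt hκ (by
    rw [Cardinal.mk_option]
    exact Cardinal.add_lt_of_lt hκ hJ (Cardinal.one_lt_aleph0.trans_le hκ))
  obtain ⟨g, hg, hga⟩ := hΓ'.2 G P a p' haepi hp' (hM'.isPro hC hΓ hf) (hN.rank_lt hκ hJ) hG.le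
  exact ⟨G, Q, f, g, a, b, hf, hg, ha, hga, hQ, hb ▸ hqB⟩

/-- One back-and-forth step. -/
lemma exists_back_and_forth {C : ProalgebraicGroup.{u, v} k → Prop} (hC : IsFormation C)
    (hΓ : IsSaturated C Γ) (hΓ' : IsSaturated C Γ') (hrank : Γ.rank = Γ'.rank)
    (hκ : Cardinal.aleph0 ≤ Γ.rank) {J : Type v} (hJ : Cardinal.mk J < Γ.rank)
    {T : J → Subalgebra k (Γ.coordRing × Γ'.coordRing)}
    (hT : ∀ j, IsHopfCorrespondence (T j)) (hfg : ∀ j, (T j).FG)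
    (hR : IsBiinjective (⨆ j, T j)) (B : Γ.CoalgebraicSubgroup) (B' : Γ'.CoalgebraicSubgroup) :
    ∃ T' : Subalgebra k (Γ.coordRing × Γ'.coordRing), IsHopfCorrespondence T' ∧ T'.FG ∧
      IsBiinjective ((⨆ j, T j) ⊔ T') ∧ B.quotientRing ≤ T'.map (AlgHom.fst k _ _) ∧
        B'.quotientRing ≤ T'.map (AlgHom.snd k _ _) := by
  obtain ⟨P, p, p', N, hp, hp', hrange, hN⟩ := exists_common_quotient_separates hT hfg hR
  obtain ⟨G, Q, f, g, a, b, hf, hg, rfl, rfl, hQ, hB⟩ :=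
    hΓ'.exists_extension hC hΓ.1 (hrank ▸ hκ) hp hp' hN (hrank ▸ hJ) B
  -- Only the graph of the algebraic quotient `Q` is added, not that of `G`: the new generator must
  -- be finitely generated.
  let T₁ := (dualPair (f ≫ b) (g ≫ b)).range
  have hT₁ : IsHopfCorrespondence T₁ := isHopfCorrespondence_range_dualPair _ _
  have hT₁fg : T₁.FG := range_dualPair_fg _ _ hQ
  let S : Option J → Subalgebra k (Γ.coordRing × Γ'.coordRing) := fun o => o.elim T₁ T
  have hS : ⨆ o, S o = T₁ ⊔ ⨆ j, T j := iSup_option _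
  have hSinj : IsBiinjective (⨆ o, S o) := by
    refine (isBiinjective_range_dualPair hf hg).mono ?_
    rw [hS, ← hrange]
    exact sup_le (range_dualPair_comp_le f g b) (range_dualPair_comp_le f g a)
  obtain ⟨P₂, p₂, p₂', N₂, hp₂, hp₂', hrange₂, hN₂⟩ := exists_common_quotient_separates (T := S)
    (by rintro (_ | j); exacts [hT₁, hT j]) (by rintro (_ | j); exacts [hT₁fg, hfg j]) hSinj
  -- The same extension with the two groups exchanged, starting from the correspondence already
  -- enlarged by `T₁`.
  obtain ⟨G₂, Q₂, f₂, g₂, a₂, b₂, hf₂, hg₂, rfl, rfl, hQ₂, hB₂⟩ :=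
    hΓ.exists_extension hC hΓ'.1 hκ hp₂' hp₂ hN₂ (by
      rw [Cardinal.mk_option]
      exact Cardinal.add_lt_of_lt hκ hJ (Cardinal.one_lt_aleph0.trans_le hκ)) B'
  refine ⟨T₁ ⊔ (dualPair (g₂ ≫ b₂) (f₂ ≫ b₂)).range,
    hT₁.sup (isHopfCorrespondence_range_dualPair _ _), hT₁fg.sup (range_dualPair_fg _ _ hQ₂),
    ?_, ?_, ?_⟩
  · refine (isBiinjective_range_dualPair hg₂ hf₂).mono ?_
    have h1 : T₁ ⊔ ⨆ j, T j ≤ (dualPair g₂ f₂).range := by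
      rw [← hS, ← hrange₂]
      exact range_dualPair_comp_le g₂ f₂ a₂
    exact sup_le (le_sup_right.trans h1)
      (sup_le (le_sup_left.trans h1) (range_dualPair_comp_le g₂ f₂ b₂))
  · rw [← hB, ← map_fst_range_dualPair (f ≫ b) (g ≫ b)]
    exact Subalgebra.map_mono le_sup_left
  · rw [← hB₂, ← map_snd_range_dualPair (g₂ ≫ b₂) (f₂ ≫ b₂)]
    exact Subalgebra.map_mono le_sup_right

/-- The back-and-forth construction along a well-order all of whose initial segments are small. -/
lemma exists_exhausting_family {C : ProalgebraicGroup.{u, v} k → Prop} (hC : IsFormation C)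
    (hΓ : IsSaturated C Γ) (hΓ' : IsSaturated C Γ') (hrank : Γ.rank = Γ'.rank)
    (hκ : Cardinal.aleph0 ≤ Γ.rank) {ι : Type v} [LinearOrder ι] [WellFoundedLT ι]
    (hι : ∀ i : ι, Cardinal.mk (Set.Iio i) < Γ.rank) (B : ι → Γ.CoalgebraicSubgroup)
    (B' : ι → Γ'.CoalgebraicSubgroup) :
    ∃ T : ι → Subalgebra k (Γ.coordRing × Γ'.coordRing), (∀ i, IsHopfCorrespondence (T i)) ∧
      IsBiinjective (⨆ i, T i) ∧ (∀ i, (B i).quotientRing ≤ (T i).map (AlgHom.fst k _ _)) ∧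
        ∀ i, (B' i).quotientRing ≤ (T i).map (AlgHom.snd k _ _) := by
  classical
  let Good (i : ι) (R T : Subalgebra k (Γ.coordRing × Γ'.coordRing)) : Prop :=
    IsHopfCorrespondence T ∧ T.FG ∧ IsBiinjective (R ⊔ T) ∧
      (B i).quotientRing ≤ T.map (AlgHom.fst k _ _) ∧
        (B' i).quotientRing ≤ T.map (AlgHom.snd k _ _)
  -- The default `⊥` is never taken: `hgood` shows by induction that a good extension exists at
  -- every stage.
  let step (i : ι) (R : Subalgebra k (Γ.coordRing × Γ'.coordRing)) :
      Subalgebra k (Γ.coordRing × Γ'.coordRing) :=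
    if h : ∃ T, Good i R T then h.choose else ⊥
  let T : ι → Subalgebra k (Γ.coordRing × Γ'.coordRing) :=
    wellFounded_lt.fix fun i rec => step i (⨆ j : Set.Iio i, rec j.1 j.2)
  let R (i : ι) : Subalgebra k (Γ.coordRing × Γ'.coordRing) := ⨆ j : Set.Iio i, T j
  have hTR (i : ι) : T i = step i (R i) := wellFounded_lt.fix_eq _ i
  have hmono : Monotone fun i => R i ⊔ T i := by
    intro i j hij
    obtain rfl | hlt := hij.eq_or_lt
    · exact le_rfl
    · exact le_sup_of_le_left (sup_le
        (iSup_le fun l => le_iSup (fun l : Set.Iio j => T l) ⟨l, l.2.trans hlt⟩)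
        (le_iSup (fun l : Set.Iio j => T l) ⟨i, hlt⟩))
  have hgood (i : ι) : Good i (R i) (T i) := by
    induction i using WellFoundedLT.induction with
    | ind i ih =>
      -- The join of the earlier `T j` lies in the join of the chain `R j ⊔ T j`, which is directed,
      -- as the `T j` alone need not be.
      have hR : IsBiinjective (R i) := by
        refine (IsBiinjective.iSup (R := fun j : Set.Iio i => R j ⊔ T j) ?_
          fun j => (ih j j.2).2.2.1).mono (iSup_mono fun j => le_sup_right)
        exact Monotone.directed_le fun a b hab => hmono hab
      have hex : ∃ T', Good i (R i) T' := exists_back_and_forth hC hΓ hΓ' hrank hκ (hι i)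
        (fun j => (ih j j.2).1) (fun j => (ih j j.2).2.1) hR (B i) (B' i)
      rw [hTR]
      simp only [step, dif_pos hex]
      exact hex.choose_spec
  refine ⟨T, fun i => (hgood i).1, ?_, fun i => (hgood i).2.2.2.1, fun i => (hgood i).2.2.2.2⟩
  exact (IsBiinjective.iSup hmono.directed_le fun i => (hgood i).2.2.1).mono
    (iSup_mono fun i => le_sup_right)

lemma IsTrivial.nonempty_iso {G H : ProalgebraicGroup.{u, v} k} (hG : G.IsTrivial)
    (hH : H.IsTrivial) : Nonempty (G ≅ H) := by
  let f : G ⟶ H := ofDual ((unitBialgHom k G.coordRing).comp (counitBialgHom k H.coordRing))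
  refine nonempty_iso_of_bijective f ?_
  have hf (c : k) : dual f (algebraMap k _ c) = algebraMap k _ c := AlgHomClass.commutes (dual f) c
  have : ⇑(dual f) ∘ algebraMap k H.coordRing = algebraMap k G.coordRing := funext hf
  exact (Function.Bijective.of_comp_iff _ hH).mp (this ▸ hG)

end ProalgebraicGroup

theorem theorem3p30 {k : Type u} [Field k]
    (C : ProalgebraicGroup.{u, v} k → Prop) (hC : ProalgebraicGroup.IsFormation C)
    (Γ Γ' : ProalgebraicGroup.{u, v} k)
    (hΓ : ProalgebraicGroup.IsSaturated C Γ) (hΓ' : ProalgebraicGroup.IsSaturated C Γ')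
    (hrank : Γ.rank = Γ'.rank) :
    Nonempty (Γ ≅ Γ') := by
  open ProalgebraicGroup in
  by_cases htriv : Γ.IsTrivial
  · exact htriv.nonempty_iso (rank_eq_zero_iff.mp (hrank ▸ htriv.rank_eq_zero))
  have htriv' : ¬ Γ'.IsTrivial := fun h => htriv (rank_eq_zero_iff.mp (hrank ▸ h.rank_eq_zero))
  have hκ := hΓ.aleph0_le_rank hC htriv
  obtain ⟨S, hS, hcard⟩ := exists_isNeighborhoodBasis_mk_eq_rank htriv
  obtain ⟨S', hS', hcard'⟩ := exists_isNeighborhoodBasis_mk_eq_rank htriv'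
  obtain ⟨e⟩ := Cardinal.eq.mp ((Cardinal.mk_ord_toType Γ.rank).trans hcard.symm)
  obtain ⟨e'⟩ := Cardinal.eq.mp ((Cardinal.mk_ord_toType Γ.rank).trans (hrank.trans hcard'.symm))
  -- The order type is the initial ordinal of the rank, so proper initial segments have smaller
  -- cardinality.
  obtain ⟨T, hT, hinj, hB, hB'⟩ := exists_exhausting_family hC hΓ hΓ' hrank hκ
    (ι := Γ.rank.ord.ToType) (fun i => (Cardinal.mk_Iio_lt i (by simp)).trans_eq (Cardinal.mk_ord_toType _))
    (fun i => (e i).1) fun i => (e' i).1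
  obtain ⟨P, p, p', hp, hp', hrange⟩ :=
    (IsHopfCorrespondence.iSup hT).exists_common_quotient hinj
  -- Any `a` lies in the quotient ring of some basis member, and that ring was absorbed at the stage
  -- indexed by this member.
  have hsurj : Function.Surjective (dual p) := fun a => by
    obtain ⟨N, hN, hle⟩ := hΓ.1.exists_mem_of_isNeighborhoodBasis hC hS
      (D := Algebra.adjoin k {a}) ⟨{a}, by simp⟩
    obtain ⟨i, hi⟩ := e.surjective ⟨N, hN⟩
    have h := (hB i).trans (Subalgebra.map_mono (le_iSup T i))
    rw [hi, ← hrange, map_fst_range_dualPair] at h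
    exact h (hle (Algebra.self_mem_adjoin_singleton k a))
  have hsurj' : Function.Surjective (dual p') := fun a => by
    obtain ⟨N, hN, hle⟩ := hΓ'.1.exists_mem_of_isNeighborhoodBasis hC hS'
      (D := Algebra.adjoin k {a}) ⟨{a}, by simp⟩
    obtain ⟨i, hi⟩ := e'.surjective ⟨N, hN⟩
    have h := (hB' i).trans (Subalgebra.map_mono (le_iSup T i))
    rw [hi, ← hrange, map_snd_range_dualPair] at h
    exact h (hle (Algebra.self_mem_adjoin_singleton k a))
  obtain ⟨α⟩ := nonempty_iso_of_bijective p ⟨hp, hsurj⟩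
  obtain ⟨β⟩ := nonempty_iso_of_bijective p' ⟨hp', hsurj'⟩
  exact ⟨α ≪≫ β.symm⟩
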